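/- Consider the convex program $$\min_{x\in\mathbb R^n} f(x)\quad\text{subject to}\quad g_i(x)\le 0\ (i=1,\dots,m_I),\qquad Ax=b,$$ where $f,g_1,\dots,g_{m_I}:\mathbb R^n\to\mathbb R$ are continuously differentiable and convex, $A\in\mathbb R^{m_E\times n}$ and $b\in\mathbb R^{m_E}$. Let $\rho>0$. The augmented primal-dual gradient dynamics (Aug-PDGD) for $z=(x,\lambda,\nu)\in\mathbb R^n\times\mathbb R^{m_I}\times\mathbb R^{m_E}$ is $$\dot x=-\nabla f(x)-A^T\nu-\sum_{i=1}^{m_I}[\rho g_i(x)+\lambda_i]_+\nabla g_i(x),\qquad \dot\lambda_i=\frac{[\rho g_i(x)+\lambda_i]_+-\lambda_i}{\rho},\qquad \dot\nu=Ax-b,$$ where $[u]_+=\max\{u,0\}$; the right-hand sides are $-\nabla_xL_\rho$, $\nabla_\lambda L_\rho$, $\nabla_\nu L_\rho$ for the augmented Lagrangian $L_\rho(x,\lambda,\nu)=f(x)+\sum_{i}\frac{[\rho g_i(x)+\lambda_i]_+^2-\lambda_i^2}{2\rho}+\nu^T(Ax-b)$. All norms are Euclidean, $\|z\|^2=\|x\|^2+\|\lambda\|^2+\|\nu\|^2$.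 Assume: 1. The program is feasible and $f$ is $\mu$-strongly convex for some $\mu>0$. Let $x^*$ denote its unique optimal solution. 2. With $\mathcal I=\{i: g_i(x^*)=0\}$, the vectors $\nabla g_i(x^*)$, $i\in\mathcal I$, together with the rows of $A$ are linearly independent, and $|\mathcal I|+m_E>0$. 3. $\nabla f$ is $\ell$-Lipschitz continuous; and for every $d\ge 0$ and every $i$ there are $L_{g,i},M_{g,i}\ge 0$ such that on the ball $\{y:\|y-x^*\|\le d\}$ one has $\|\nabla g_i\|\le L_{g,i}$ and $\nabla g_i$ is $M_{g,i}$-Lipschitz continuous. Then the program has a unique KKT point $z^*=(x^*,\lambda^*,\nu^*)$, and $z^*$ is a semi-globally exponentially stable equilibrium of the Aug-PDGD with initial points restricted to $\lambda(0)\ge 0$. That is, $z^*$ is an equilibrium, and for every $h>0$ there are $M>0$ and $\beta>0$ such that for every initial point $z(0)=(x(0),\lambda(0),\nu(0))$ with $\lambda(0)\ge0$ and $\|z(0)-z^*\|\le h$ a solution of the Aug-PDGD on $[0,\infty)$ exists, and every such solution satisfies $$\|z(t)-z^*\|\le M e^{-\beta t}\|z(0)-z^*\|\qquad\text{for all } t\ge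 0.$$ Moreover, for every $h>0$ one can take $M=2$ (with a suitable $\beta>0$ depending on $h$). -/

import Mathlib

/-- The data of a smooth convex program
`min f(x)` subject to `g_i(x) ≤ 0` for `i = 1, …, mI` and `A x = b`,
with `f` and all `g_i` continuously differentiable and convex on `ℝⁿ`. -/
structure ConvexProgram (n mI mE : ℕ) where
  f : EuclideanSpace ℝ (Fin n) → ℝ
  g : Fin mI → EuclideanSpace ℝ (Fin n) → ℝ
  A : Matrix (Fin mE) (Fin n) ℝ
  b : EuclideanSpace ℝ (Fin mE)
  contDiff_f : ContDiff ℝ 1 f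
  convex_f : ConvexOn ℝ Set.univ f
  contDiff_g : ∀ i, ContDiff ℝ 1 (g i)
  convex_g : ∀ i, ConvexOn ℝ Set.univ (g i)

/-- The space of primal-dual points `z = (x, λ, ν)` with the Euclidean norm
`‖z‖ = (‖x‖² + ‖λ‖² + ‖ν‖²)^{1/2}`. -/
abbrev PDSpace (n mI mE : ℕ) : Type :=
  WithLp 2 (EuclideanSpace ℝ (Fin n) ×
    WithLp 2 (EuclideanSpace ℝ (Fin mI) × EuclideanSpace ℝ (Fin mE)))

namespace PDSpace

variable {n mI mE : ℕ}

/-- The primal component `x`. -/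
abbrev x (z : PDSpace n mI mE) : EuclideanSpace ℝ (Fin n) := z.fst

/-- The multiplier `λ` of the inequality constraints. -/
abbrev lam (z : PDSpace n mI mE) : EuclideanSpace ℝ (Fin mI) := z.snd.fst

/-- The multiplier `ν` of the equality constraints. -/
abbrev nu (z : PDSpace n mI mE) : EuclideanSpace ℝ (Fin mE) := z.snd.snd

/-- The point `(x, λ, ν)`. -/
abbrev mk (x : EuclideanSpace ℝ (Fin n)) (l : EuclideanSpace ℝ (Fin mI))
    (v : EuclideanSpace ℝ (Fin mE)) : PDSpace n mI mE :=
  WithLp.toLp 2 (x, WithLp.toLp 2 (l, v))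

/-- The primal-dual points with `λ ≥ 0`. -/
def lamNonneg (n mI mE : ℕ) : Set (PDSpace n mI mE) :=
  {z | ∀ i, 0 ≤ z.lam i}

end PDSpace

namespace ConvexProgram

variable {n mI mE : ℕ} (P : ConvexProgram n mI mE)

/-- `x` satisfies all constraints. -/
def IsFeasible (x : EuclideanSpace ℝ (Fin n)) : Prop :=
  (∀ i, P.g i x ≤ 0) ∧ Matrix.toEuclideanLin P.A x = P.b

/-- `x` is an optimal solution of the program. -/
def IsSolution (x : EuclideanSpace ℝ (Fin n)) : Prop :=
  P.IsFeasible x ∧ ∀ y, P.IsFeasible y → P.f x ≤ P.f y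

/-- The set of the inequality constraints that are active at `x`. -/
def activeSet (x : EuclideanSpace ℝ (Fin n)) : Set (Fin mI) :=
  {i | P.g i x = 0}

/-- Linear independence constraint qualification at `x`: the gradients of the active inequality
constraints together with the rows of `A` form a linearly independent family. -/
def LICQ (x : EuclideanSpace ℝ (Fin n)) : Prop :=
  LinearIndependent ℝ
    (Sum.elim (fun i : P.activeSet x => gradient (P.g i) x)
      (fun j : Fin mE => (WithLp.toLp 2 (P.A j) : EuclideanSpace ℝ (Fin n))))

/-- `z = (x, λ, ν)` is a KKT point of the program. -/
structure IsKKT (z : PDSpace n mI mE) : Prop where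
  stationarity : gradient P.f z.x + Matrix.toEuclideanLin P.A.transpose z.nu
    + ∑ i, z.lam i • gradient (P.g i) z.x = 0
  feasible : P.IsFeasible z.x
  lam_nonneg : ∀ i, 0 ≤ z.lam i
  complementarity : ∀ i, z.lam i * P.g i z.x = 0

/-- The augmented Lagrangian
`L_ρ(x, λ, ν) = f(x) + ∑ i, ([ρ g_i(x) + λ_i]₊² - λ_i²) / (2ρ) + νᵀ(A x - b)`. -/
noncomputable def augLagrangian (ρ : ℝ) (x : EuclideanSpace ℝ (Fin n))
    (l : EuclideanSpace ℝ (Fin mI)) (v : EuclideanSpace ℝ (Fin mE)) : ℝ :=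
  P.f x + ∑ i, ((max (ρ * P.g i x + l i) 0) ^ 2 - (l i) ^ 2) / (2 * ρ)
    + inner ℝ v (Matrix.toEuclideanLin P.A x - P.b)

/-- The vector field of the augmented primal-dual gradient dynamics:
`ẋ = -∇f(x) - Aᵀν - ∑ i, [ρ g_i(x) + λ_i]₊ ∇g_i(x)`,
`λ̇_i = ([ρ g_i(x) + λ_i]₊ - λ_i) / ρ`, `ν̇ = A x - b`. -/
noncomputable def augPDGD (ρ : ℝ) (z : PDSpace n mI mE) : PDSpace n mI mE :=
  PDSpace.mk
    (-gradient P.f z.x - Matrix.toEuclideanLin P.A.transpose z.nu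
      - ∑ i, max (ρ * P.g i z.x + z.lam i) 0 • gradient (P.g i) z.x)
    (WithLp.toLp 2 fun i => (max (ρ * P.g i z.x + z.lam i) 0 - z.lam i) / ρ)
    (Matrix.toEuclideanLin P.A z.x - P.b)

/-- The derivative of `u ↦ [u]₊²`. -/
theorem hasDerivAt_posPart_sq (u : ℝ) :
    HasDerivAt (fun s : ℝ => (max s 0) ^ 2) (2 * max u 0) u := by
  rcases lt_trichotomy u 0 with h | h | h
  · rw [max_eq_right h.le, mul_zero]
    refine (hasDerivAt_const u (0 : ℝ)).congr_of_eventuallyEq ?_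
    filter_upwards [Iio_mem_nhds h] with s hs
    simp [max_eq_right (le_of_lt (show s < 0 from hs))]
  · subst h
    rw [max_self, mul_zero, hasDerivAt_iff_isLittleO_nhds_zero]
    have h2 : (fun s : ℝ => s ^ 2) =o[nhds 0] fun s : ℝ => s := by
      simpa using Asymptotics.isLittleO_pow_pow (𝕜 := ℝ) (one_lt_two)
    refine Asymptotics.IsBigO.trans_isLittleO (Asymptotics.IsBigO.of_bound 1 ?_) h2
    refine Filter.Eventually.of_forall fun s => ?_
    rcases le_total s 0 with hs | hs
    · simp [max_eq_right hs, sq_nonneg]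
    · simp [max_eq_left hs]
  · rw [max_eq_left h.le]
    have h1 : HasDerivAt (fun s : ℝ => s ^ 2) (2 * u) u := by
      simpa using hasDerivAt_pow 2 u
    refine h1.congr_of_eventuallyEq ?_
    filter_upwards [Ioi_mem_nhds h] with s hs
    simp [max_eq_left (le_of_lt (show 0 < s from hs))]

/-- The vector field is `(-∇ₓ L_ρ, ∇_λ L_ρ, ∇_ν L_ρ)`. -/
theorem augPDGD_eq_gradient {ρ : ℝ} (hρ : 0 < ρ) (z : PDSpace n mI mE) :
    P.augPDGD ρ z = PDSpace.mk
      (-gradient (fun x => P.augLagrangian ρ x z.lam z.nu) z.x)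
      (gradient (fun l => P.augLagrangian ρ z.x l z.nu) z.lam)
      (gradient (fun v => P.augLagrangian ρ z.x z.lam v) z.nu) := by
  have hadj : ∀ w : EuclideanSpace ℝ (Fin n),
      inner ℝ z.nu (Matrix.toEuclideanLin P.A w)
        = inner ℝ (Matrix.toEuclideanLin P.A.transpose z.nu) w := by
    intro w
    have := Matrix.toEuclideanLin_conjTranspose_eq_adjoint P.A
    rw [Matrix.conjTranspose_eq_transpose_of_trivial] at this
    rw [this, LinearMap.adjoint_inner_left]
  have hx : HasGradientAt (fun x => P.augLagrangian ρ x z.lam z.nu)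
      (gradient P.f z.x + ∑ i, max (ρ * P.g i z.x + z.lam i) 0 • gradient (P.g i) z.x
        + Matrix.toEuclideanLin P.A.transpose z.nu) z.x := by
    have h1 := ((P.contDiff_f.differentiable one_ne_zero) z.x).hasGradientAt.hasFDerivAt
    have h2 : ∀ i ∈ Finset.univ, HasFDerivAt
        (fun x => ((max (ρ * P.g i x + z.lam i) 0) ^ 2 - (z.lam i) ^ 2) / (2 * ρ))
        (InnerProductSpace.toDual ℝ _
          (max (ρ * P.g i z.x + z.lam i) 0 • gradient (P.g i) z.x)) z.x := by
      intro i _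
      have hg := (((P.contDiff_g i).differentiable one_ne_zero) z.x).hasGradientAt.hasFDerivAt
      have := ((((hasDerivAt_posPart_sq (ρ * P.g i z.x + z.lam i)).comp_hasFDerivAt z.x
        ((hg.const_mul ρ).add_const (z.lam i))).sub_const ((z.lam i) ^ 2)).mul_const (2 * ρ)⁻¹)
      refine HasFDerivAt.congr_fderiv this ?_
      ext w
      simp
      field_simp
    have h3 : HasFDerivAt (fun x => inner ℝ z.nu (Matrix.toEuclideanLin P.A x - P.b))
        (InnerProductSpace.toDual ℝ _ (Matrix.toEuclideanLin P.A.transpose z.nu)) z.x := by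
      have : (fun x => inner ℝ z.nu (Matrix.toEuclideanLin P.A x - P.b))
          = fun x => InnerProductSpace.toDual ℝ _ (Matrix.toEuclideanLin P.A.transpose z.nu) x
            - inner ℝ z.nu P.b := by
        funext x
        rw [inner_sub_right, hadj, InnerProductSpace.toDual_apply_apply]
      rw [this]
      exact (ContinuousLinearMap.hasFDerivAt _).sub_const _
    rw [hasGradientAt_iff_hasFDerivAt]
    have := (h1.add (HasFDerivAt.fun_sum h2)).add h3
    refine HasFDerivAt.congr_fderiv this ?_
    simp only [map_add, map_sum]
  have hl : HasGradientAt (fun l => P.augLagrangian ρ z.x l z.nu)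
      (WithLp.toLp 2 fun i => (max (ρ * P.g i z.x + z.lam i) 0 - z.lam i) / ρ) z.lam := by
    rw [hasGradientAt_iff_hasFDerivAt]
    have h2 : ∀ i ∈ Finset.univ, HasFDerivAt
        (fun l : EuclideanSpace ℝ (Fin mI) =>
          ((max (ρ * P.g i z.x + l i) 0) ^ 2 - (l i) ^ 2) / (2 * ρ))
        (((max (ρ * P.g i z.x + z.lam i) 0 - z.lam i) / ρ) •
          (EuclideanSpace.proj i : EuclideanSpace ℝ (Fin mI) →L[ℝ] ℝ)) z.lam := by
      intro i _
      have hp := (EuclideanSpace.proj i : EuclideanSpace ℝ (Fin mI) →L[ℝ] ℝ).hasFDerivAt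
        (x := z.lam)
      have := (((hasDerivAt_posPart_sq (ρ * P.g i z.x + z.lam i)).comp_hasFDerivAt z.lam
        (hp.const_add (ρ * P.g i z.x))).sub (hp.pow 2)).mul_const (2 * ρ)⁻¹
      refine HasFDerivAt.congr_fderiv this ?_
      ext w
      simp
      field_simp
    have := ((HasFDerivAt.fun_sum h2).const_add (P.f z.x)).add_const
      (inner ℝ z.nu (Matrix.toEuclideanLin P.A z.x - P.b))
    refine HasFDerivAt.congr_fderiv this ?_
    ext w
    simp [PiLp.inner_apply, mul_comm]
  have hv : HasGradientAt (fun v => P.augLagrangian ρ z.x z.lam v)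
      (Matrix.toEuclideanLin P.A z.x - P.b) z.nu := by
    rw [hasGradientAt_iff_hasFDerivAt]
    have := ((InnerProductSpace.toDual ℝ _
      (Matrix.toEuclideanLin P.A z.x - P.b)).hasFDerivAt (x := z.nu)).const_add
      (P.f z.x + ∑ i, ((max (ρ * P.g i z.x + z.lam i) 0) ^ 2 - (z.lam i) ^ 2) / (2 * ρ))
    refine this.congr_of_eventuallyEq (Filter.Eventually.of_forall fun v => ?_)
    simp only [augLagrangian, InnerProductSpace.toDual_apply_apply]
    rw [real_inner_comm]
  rw [hx.gradient, hl.gradient, hv.gradient, augPDGD]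
  congr 2
  abel

end ConvexProgram

/-- Exponential decay estimate for `ż = φ(z)` with constants `M`, `β`, for the initial points in `D`
at distance at most `h` from `ze`: a solution on `[0, ∞)` exists, and every solution satisfies
`‖z(t) - ze‖ ≤ M e^{-β t} ‖z(0) - ze‖` for all `t ≥ 0`. -/
def ExpDecayFrom {E : Type*} [NormedAddCommGroup E] [NormedSpace ℝ E] (φ : E → E) (D : Set E)
    (ze : E) (h M β : ℝ) : Prop :=
  ∀ z₀ ∈ D, ‖z₀ - ze‖ ≤ h →
    (∃ z : ℝ → E, z 0 = z₀ ∧ IsIntegralCurveOn z (fun _ => φ) (Set.Ici 0)) ∧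
    ∀ z : ℝ → E, z 0 = z₀ → IsIntegralCurveOn z (fun _ => φ) (Set.Ici 0) →
      ∀ t : ℝ, 0 ≤ t → ‖z t - ze‖ ≤ M * Real.exp (-β * t) * ‖z 0 - ze‖

/-- `ze` is a semi-globally exponentially stable equilibrium of `ż = φ(z)`, with the initial
points restricted to `D`. -/
def IsSemiGloballyExpStable {E : Type*} [NormedAddCommGroup E] [NormedSpace ℝ E] (φ : E → E)
    (D : Set E) (ze : E) : Prop :=
  φ ze = 0 ∧ ∀ h : ℝ, 0 < h → ∃ M : ℝ, 0 < M ∧ ∃ β : ℝ, 0 < β ∧ ExpDecayFrom φ D ze h M β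

/-! Write `s_i = [ρ g_i(x) + λ_i]₊ - λ_i`. Strong convexity of `f`, convexity of the `g_i` and
complementarity give `⟪ż, z - z*⟫ ≤ -D` everywhere, with `D = μ‖x - x*‖² + ‖s‖²/ρ`
(`IsKKT.inner_augPDGD_le`). Hence the distance to `z*` never increases, solutions are global, and
each stays in its initial ball.

`D` does not see all multiplier errors, so the squared distance alone yields no rate. The remedy is
the Lyapunov function `V = ‖z - z*‖² + 2ε⟪x - x*, Q(z - z*)⟫`, where `Q(x, λ, ν) = ∑ λ_i ∇g_i(x*) +
Aᵀν`. On a ball, `ẋ = -Q(z - z*)` up to an error of order `√D`, so the cross term contributes `-‖Q(z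
- z*)‖²/2 + O(D)` (`IsKKT.exists_crossTerm_le`). By LICQ, `Q` bounds `ν - ν*` and the active
multiplier errors; the inactive ones are bounded by `D` on the ball (`IsKKT.exists_sq_lam_le`). For
small `ε`, `V` decays exponentially and lies between `‖z - z*‖²/2` and `2‖z - z*‖²`
(`exists_expDecayFrom_two`). These two bounds give the factor `2`; the ball affects only the rate.

The KKT point comes from Farkas' lemma for a linearly independent family, and LICQ makes its
multipliers unique. -/

/-! ### Global solutions of bounded Lipschitz fields -/

open Set Metric in
/-- A bounded Lipschitz vector field has a solution on `[0, ∞)` from every initial point. -/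
theorem exists_isIntegralCurveOn_Ici_of_bounded {E : Type*} [NormedAddCommGroup E]
    [NormedSpace ℝ E] [CompleteSpace E] {φ : E → E} {K C : NNReal} (hK : LipschitzWith K φ)
    (hC : ∀ z, ‖φ z‖ ≤ C) (z₀ : E) :
    ∃ z : ℝ → E, z 0 = z₀ ∧ IsIntegralCurveOn z (fun _ => φ) (Ici 0) := by
  have hloc : ∀ N : ℕ, ∃ c : ℝ → E, c 0 = z₀ ∧
      ∀ t ∈ Icc (0 : ℝ) N, HasDerivWithinAt c (φ (c t)) (Icc 0 (N : ℝ)) t := by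
    intro N
    -- At speed at most `C`, a curve cannot leave the ball of radius `C * N` by time `N`, so
    -- Picard–Lindelöf covers all of `[0, N]` at once.
    have hpl : IsPicardLindelof (fun _ : ℝ => φ) (tmin := 0) (tmax := N)
        ⟨0, le_refl _, Nat.cast_nonneg N⟩ z₀ (C * N) 0 C K :=
      { lipschitzOnWith := fun _ _ => hK.lipschitzOnWith
        continuousOn := fun _ _ => continuousOn_const
        norm_le := fun _ _ z _ => hC z
        mul_max_le := by simp }
    exact hpl.exists_eq_forall_mem_Icc_hasDerivWithinAt₀
  choose c hc0 hc using hloc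
  have hIci : ∀ N : ℕ, ∀ t ∈ Ico (0 : ℝ) N, HasDerivWithinAt (c N) (φ (c N t)) (Ici t) t := by
    intro N t ht
    exact (hc N t ⟨ht.1, ht.2.le⟩).mono_of_mem_nhdsWithin
      (Filter.mem_of_superset (Icc_mem_nhdsGE ht.2) (Icc_subset_Icc_left ht.1))
  have hcont : ∀ N : ℕ, ContinuousOn (c N) (Icc 0 (N : ℝ)) :=
    fun N t ht => (hc N t ht).continuousWithinAt
  have hagree : ∀ N M : ℕ, N ≤ M → EqOn (c N) (c M) (Icc 0 (N : ℝ)) := by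
    intro N M hNM
    have hle : (N : ℝ) ≤ M := by exact_mod_cast hNM
    exact ODE_solution_unique (v := fun _ => φ) (fun _ => hK) (hcont N) (hIci N)
      ((hcont M).mono (Icc_subset_Icc_right hle))
      (fun t ht => hIci M t ⟨ht.1, ht.2.trans_le hle⟩) (by rw [hc0, hc0])
  -- The `+ 1` puts `t` strictly before the right endpoint, so that `[0, N]` is a neighbourhood of
  -- `t` within `[0, ∞)`.
  have hglue : ∀ N : ℕ, EqOn (fun t => c (⌈t⌉₊ + 1) t) (c N) (Icc 0 (N : ℝ)) := by
    intro N t ht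
    have ht' : t ≤ ((⌈t⌉₊ + 1 : ℕ) : ℝ) := by
      push_cast
      linarith [Nat.le_ceil t]
    rcases le_total (⌈t⌉₊ + 1) N with h | h
    · exact hagree _ _ h ⟨ht.1, ht'⟩
    · exact (hagree _ _ h ht).symm
  refine ⟨fun t => c (⌈t⌉₊ + 1) t, by simp [hc0], fun t ht => ?_⟩
  have hlt : t < ((⌈t⌉₊ + 1 : ℕ) : ℝ) := by
    push_cast
    linarith [Nat.le_ceil t]
  have hmem : t ∈ Icc (0 : ℝ) ((⌈t⌉₊ + 1 : ℕ) : ℝ) := ⟨ht, hlt.le⟩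
  refine ((hc _ t hmem).congr (hglue _) (hglue _ hmem)).mono_of_mem_nhdsWithin ?_
  filter_upwards [self_mem_nhdsWithin, nhdsWithin_le_nhds (Iio_mem_nhds hlt)] with s hs hs'
  exact ⟨hs, le_of_lt hs'⟩

/-! ### Dissipative fields and the Lyapunov argument -/

section Dissipative

variable {E : Type*} [NormedAddCommGroup E] [InnerProductSpace ℝ E]

open Set Metric

/-- A differentiable real function on `[0, ∞)` with `V' ≤ -k V` decays exponentially. -/
theorem le_exp_mul_of_hasDerivWithinAt {V V' : ℝ → ℝ} {k : ℝ}
    (hV : ∀ t ∈ Ici (0 : ℝ), HasDerivWithinAt V (V' t) (Ici 0) t)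
    (hle : ∀ t ∈ Ici (0 : ℝ), V' t ≤ -k * V t) {t : ℝ} (ht : 0 ≤ t) :
    V t ≤ Real.exp (-k * t) * V 0 := by
  have hW : ∀ s ∈ Ici (0 : ℝ), HasDerivWithinAt (fun s => Real.exp (k * s) * V s)
      (Real.exp (k * s) * (k * V s + V' s)) (Ici 0) s := by
    intro s hs
    have h1 : HasDerivWithinAt (fun s => Real.exp (k * s)) (Real.exp (k * s) * (k * 1)) (Ici 0) s :=
      (((hasDerivAt_id s).const_mul k).exp).hasDerivWithinAt
    refine (h1.mul (hV s hs)).congr_deriv ?_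
    ring
  have hanti : AntitoneOn (fun s => Real.exp (k * s) * V s) (Ici 0) := by
    refine antitoneOn_of_deriv_nonpos (convex_Ici 0) (fun s hs => (hW s hs).continuousWithinAt)
      (fun s hs => ?_) (fun s hs => ?_)
    · rw [interior_Ici] at hs ⊢
      exact ((hW s (mem_Ici.2 (le_of_lt hs))).mono Ioi_subset_Ici_self).differentiableWithinAt
    · rw [interior_Ici] at hs
      rw [((hW s (mem_Ici.2 (le_of_lt hs))).hasDerivAt (Ici_mem_nhds hs)).deriv]
      exact mul_nonpos_of_nonneg_of_nonpos (Real.exp_pos _).le (by linarith [hle s (mem_Ici.2 (le_of_lt hs))])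
  have h := hanti (mem_Ici.2 le_rfl) (mem_Ici.2 ht) ht
  simp only [mul_zero, Real.exp_zero, one_mul] at h
  calc V t = Real.exp (-k * t) * (Real.exp (k * t) * V t) := by
        rw [← mul_assoc, ← Real.exp_add]
        simp
    _ ≤ _ := by gcongr

/-- Along solutions of a dissipative vector field the distance to the center does not increase. -/
theorem norm_sub_le_of_inner_nonpos {φ : E → E} {ze : E} {z : ℝ → E}
    (hdis : ∀ z, inner ℝ (φ z) (z - ze) ≤ 0)
    (hz : IsIntegralCurveOn z (fun _ => φ) (Ici 0)) {t : ℝ} (ht : 0 ≤ t) :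
    ‖z t - ze‖ ≤ ‖z 0 - ze‖ := by
  have h := le_exp_mul_of_hasDerivWithinAt (V := fun s => ‖z s - ze‖ ^ 2) (k := 0)
    (fun s hs => ((hz s hs).sub_const ze).norm_sq)
    (fun s _ => by
      have := hdis (z s)
      rw [real_inner_comm] at this
      simp only [neg_zero, zero_mul]
      linarith) ht
  simp only [neg_zero, zero_mul, Real.exp_zero, one_mul] at h
  exact (sq_le_sq₀ (norm_nonneg _) (norm_nonneg _)).1 h

/-- A dissipative vector field that is Lipschitz on all balls around the center has a solution on
`[0, ∞)` from every initial point. -/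
theorem exists_isIntegralCurveOn_Ici_of_dissipative [CompleteSpace E] {φ : E → E} {ze : E}
    (hdis : ∀ z, inner ℝ (φ z) (z - ze) ≤ 0)
    (hlip : ∀ r : ℝ, ∃ K, LipschitzOnWith K φ (closedBall ze r)) (z₀ : E) :
    ∃ z : ℝ → E, z 0 = z₀ ∧ IsIntegralCurveOn z (fun _ => φ) (Ici 0) := by
  set r := ‖z₀ - ze‖ with hr
  obtain ⟨K, hK⟩ := hlip (r + 1)
  have hK' : ∀ z ∈ closedBall ze (r + 1), ∀ w ∈ closedBall ze (r + 1),
      ‖φ z - φ w‖ ≤ K * ‖z - w‖ := fun z hz w hw => by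
    simpa [dist_eq_norm] using hK.dist_le_mul z hz w hw
  have hr0 : 0 ≤ r := norm_nonneg _
  have hK0 : (0 : ℝ) ≤ K := K.2
  set C : ℝ := ‖φ ze‖ + K * (r + 1) with hCdef
  have hC0 : 0 ≤ C := by positivity
  have hC : ∀ z ∈ closedBall ze (r + 1), ‖φ z‖ ≤ C := by
    intro z hz
    have h1 := hK' z hz ze (mem_closedBall_self (by linarith))
    have h2 : ‖z - ze‖ ≤ r + 1 := mem_closedBall_iff_norm.1 hz
    have h3 : ‖φ z‖ ≤ ‖φ ze‖ + ‖φ z - φ ze‖ := by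
      simpa using norm_add_le (φ ze) (φ z - φ ze)
    have h4 : (K : ℝ) * ‖z - ze‖ ≤ K * (r + 1) := by gcongr
    linarith
  -- This cutoff makes `χ • φ` bounded and globally Lipschitz and keeps it dissipative. Its solution
  -- therefore stays in the ball of radius `r`, where `χ = 1`, and so solves the original equation.
  let χ : E → ℝ := fun z => max 0 (min 1 (r + 1 - ‖z - ze‖))
  have hχ0 : ∀ z, 0 ≤ χ z := fun z => le_max_left _ _
  have hχ1 : ∀ z, χ z ≤ 1 := fun z => max_le zero_le_one (min_le_left _ _)
  have hχlip : ∀ z w, |χ z - χ w| ≤ ‖z - w‖ := by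
    intro z w
    have h1 : |χ z - χ w| ≤ |‖z - ze‖ - ‖w - ze‖| := by
      refine (abs_max_sub_max_le_max _ _ _ _).trans (max_le (by simp) ?_)
      refine (abs_min_sub_min_le_max _ _ _ _).trans (max_le (by simp) ?_)
      rw [abs_sub_comm]
      apply le_of_eq
      congr 1
      ring
    refine h1.trans ((abs_norm_sub_norm_le _ _).trans (by simp))
  have hχout : ∀ z, z ∉ closedBall ze (r + 1) → χ z = 0 := by
    intro z hz
    rw [mem_closedBall_iff_norm, not_le] at hz
    exact max_eq_left ((min_le_right _ _).trans (by linarith))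
  have hχin : ∀ z, ‖z - ze‖ ≤ r → χ z = 1 := by
    intro z hz
    simp only [χ]
    rw [min_eq_left (by linarith), max_eq_right zero_le_one]
  have hbd : ∀ z, ‖χ z • φ z‖ ≤ C := by
    intro z
    by_cases hz : z ∈ closedBall ze (r + 1)
    · rw [norm_smul, Real.norm_of_nonneg (hχ0 z)]
      nlinarith [hC z hz, hχ1 z, hχ0 z, norm_nonneg (φ z)]
    · simpa [hχout z hz] using hC0
  -- One point in the ball suffices: if `w` lies outside, then `χ w = 0` and `χ z ≤ ‖z - w‖`.
  have hone : ∀ z ∈ closedBall ze (r + 1), ∀ w, ‖χ z • φ z - χ w • φ w‖ ≤ (C + K) * ‖z - w‖ := by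
    intro z hz w
    have hzw := norm_nonneg (z - w)
    by_cases hw : w ∈ closedBall ze (r + 1)
    · have heq : χ z • φ z - χ w • φ w = (χ z - χ w) • φ z + χ w • (φ z - φ w) := by module
      rw [heq]
      refine (norm_add_le _ _).trans ?_
      rw [norm_smul, norm_smul, Real.norm_eq_abs, Real.norm_of_nonneg (hχ0 w)]
      have h1 : |χ z - χ w| * ‖φ z‖ ≤ ‖z - w‖ * C :=
        mul_le_mul (hχlip z w) (hC z hz) (norm_nonneg _) hzw
      have h2 : χ w * ‖φ z - φ w‖ ≤ 1 * (K * ‖z - w‖) :=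
        mul_le_mul (hχ1 w) (hK' z hz w hw) (norm_nonneg _) zero_le_one
      linarith
    · have h1 := hχlip z w
      rw [hχout w hw, sub_zero, abs_of_nonneg (hχ0 z)] at h1
      rw [hχout w hw, zero_smul, sub_zero, norm_smul, Real.norm_of_nonneg (hχ0 z)]
      have h2 : χ z * ‖φ z‖ ≤ ‖z - w‖ * C := mul_le_mul h1 (hC z hz) (norm_nonneg _) hzw
      nlinarith [mul_nonneg hK0 hzw]
  have hlipχ : LipschitzWith (Real.toNNReal (C + K)) (fun z => χ z • φ z) := by
    refine LipschitzWith.of_dist_le_mul fun z w => ?_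
    rw [Real.coe_toNNReal _ (add_nonneg hC0 hK0), dist_eq_norm, dist_eq_norm]
    by_cases hz : z ∈ closedBall ze (r + 1)
    · exact hone z hz w
    · by_cases hw : w ∈ closedBall ze (r + 1)
      · rw [norm_sub_rev, norm_sub_rev z w]
        exact hone w hw z
      · rw [hχout z hz, hχout w hw]
        simpa using mul_nonneg (add_nonneg hC0 hK0) (norm_nonneg (z - w))
  obtain ⟨z, hz0, hz⟩ := exists_isIntegralCurveOn_Ici_of_bounded hlipχ (C := Real.toNNReal C)
    (fun z => by rw [Real.coe_toNNReal _ hC0]; exact hbd z) z₀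
  refine ⟨z, hz0, fun t ht => ?_⟩
  have hball : ‖z t - ze‖ ≤ r := by
    have := norm_sub_le_of_inner_nonpos (φ := fun z => χ z • φ z) (ze := ze) (fun z => by
      rw [real_inner_smul_left]
      exact mul_nonpos_of_nonneg_of_nonpos (hχ0 z) (hdis z)) hz ht
    rwa [hz0] at this
  simpa [hχin _ hball] using hz t ht

/-- A dissipative vector field is semi-globally exponentially stable with factor `2`, if the
dissipation is compensated by the derivative of a bilinear cross term. -/
theorem exists_expDecayFrom_two [CompleteSpace E] {F : Type*} [NormedAddCommGroup F]
    [InnerProductSpace ℝ F] {φ : E → E} {ze : E} {D : E → ℝ} (p q : E →L[ℝ] F)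
    (hlip : ∀ r : ℝ, ∃ K, LipschitzOnWith K φ (closedBall ze r))
    (hD : ∀ z, 0 ≤ D z) (hdis : ∀ z, inner ℝ (φ z) (z - ze) ≤ -D z)
    {h : ℝ}
    (hcross : ∃ c > 0, ∃ C : ℝ, ∀ z, ‖z - ze‖ ≤ h →
      inner ℝ (p (φ z)) (q (z - ze)) + inner ℝ (p (z - ze)) (q (φ z))
        ≤ -c * ‖z - ze‖ ^ 2 + C * D z) (S : Set E) :
    ∃ β : ℝ, 0 < β ∧ ExpDecayFrom φ S ze h 2 β := by
  obtain ⟨c, hc, C, hcr⟩ := hcross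
  have hdis' : ∀ z, inner ℝ (φ z) (z - ze) ≤ 0 := fun z => (hdis z).trans (by linarith [hD z])
  set a : ℝ := ‖p‖ * ‖q‖ with ha
  have ha0 : 0 ≤ a := by positivity
  -- Small enough that the cross term is at most half of the squared distance (`ε * a ≤ 1 / 4`) and
  -- that its error is absorbed by the dissipation (`ε * C ≤ 1`).
  set ε : ℝ := 1 / (4 * a + |C| + 1) with hε
  have hden : 0 < 4 * a + |C| + 1 := by positivity
  have hε0 : 0 < ε := by positivity
  have hεeq : ε * (4 * a + |C| + 1) = 1 := by rw [hε]; field_simp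
  have hεa : ε * a ≤ 1 / 4 := by nlinarith [mul_nonneg hε0.le (abs_nonneg C)]
  have hεC : ε * C ≤ 1 := by nlinarith [mul_nonneg hε0.le ha0, le_abs_self C]
  refine ⟨ε * c / 2, by positivity, fun z₀ _ hz₀ =>
    ⟨exists_isIntegralCurveOn_Ici_of_dissipative hdis' hlip z₀, fun z hz0 hz t ht => ?_⟩⟩
  have hin : ∀ s ∈ Ici (0 : ℝ), ‖z s - ze‖ ≤ h := fun s hs =>
    (norm_sub_le_of_inner_nonpos hdis' hz hs).trans (by rwa [hz0])
  let Φ : ℝ → ℝ := fun s => inner ℝ (p (z s - ze)) (q (z s - ze))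
  have hΦ : ∀ s, |Φ s| ≤ a * ‖z s - ze‖ ^ 2 := by
    intro s
    refine (abs_real_inner_le_norm _ _).trans ?_
    calc ‖p (z s - ze)‖ * ‖q (z s - ze)‖ ≤ (‖p‖ * ‖z s - ze‖) * (‖q‖ * ‖z s - ze‖) := by
          gcongr <;> exact ContinuousLinearMap.le_opNorm _ _
      _ = _ := by rw [ha]; ring
  let V : ℝ → ℝ := fun s => ‖z s - ze‖ ^ 2 + 2 * ε * Φ s
  have hVlow : ∀ s, 1 / 2 * ‖z s - ze‖ ^ 2 ≤ V s := by
    intro s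
    have h1 := neg_abs_le (Φ s)
    have h2 := hΦ s
    simp only [V]
    nlinarith [mul_le_mul_of_nonneg_left h2 hε0.le, sq_nonneg ‖z s - ze‖,
      mul_le_mul_of_nonneg_right hεa (sq_nonneg ‖z s - ze‖)]
  have hVup : ∀ s, V s ≤ 2 * ‖z s - ze‖ ^ 2 := by
    intro s
    have h1 := le_abs_self (Φ s)
    have h2 := hΦ s
    simp only [V]
    nlinarith [mul_le_mul_of_nonneg_left h2 hε0.le, sq_nonneg ‖z s - ze‖,
      mul_le_mul_of_nonneg_right hεa (sq_nonneg ‖z s - ze‖)]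
  -- `V' ≤ -2D + 2ε(-c‖z - ze‖² + C D) ≤ -2εc‖z - ze‖² ≤ -εc V`.
  have hdec := le_exp_mul_of_hasDerivWithinAt (V := V) (k := ε * c)
    (V' := fun s => 2 * inner ℝ (z s - ze) (φ (z s)) + 2 * ε *
      (inner ℝ (p (z s - ze)) (q (φ (z s))) + inner ℝ (p (φ (z s))) (q (z s - ze))))
    (fun s hs => by
      have hd := (hz s hs).sub_const ze
      exact hd.norm_sq.add (((p.hasFDerivAt.comp_hasDerivWithinAt s hd).inner ℝ
        (q.hasFDerivAt.comp_hasDerivWithinAt s hd)).const_mul (2 * ε)))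
    (fun s hs => by
      have h1 := hdis (z s)
      rw [real_inner_comm] at h1
      have h2 := hcr (z s) (hin s hs)
      have h3 := hVup s
      have h4 := mul_le_mul_of_nonneg_right hεC (hD (z s))
      have h5 := mul_le_mul_of_nonneg_left h2 hε0.le
      have h6 := mul_le_mul_of_nonneg_left h3 (mul_pos hε0 hc).le
      nlinarith) ht
  have hsq : ‖z t - ze‖ ^ 2 ≤ (2 * Real.exp (-(ε * c / 2) * t) * ‖z 0 - ze‖) ^ 2 := by
    have hexp : Real.exp (-(ε * c) * t) = Real.exp (-(ε * c / 2) * t) ^ 2 := by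
      rw [← Real.exp_nat_mul]
      congr 1
      push_cast
      ring
    rw [mul_pow, mul_pow, ← hexp]
    have h1 := hVlow t
    have h2 := mul_le_mul_of_nonneg_left (hVup 0) (Real.exp_pos (-(ε * c) * t)).le
    linarith
  exact (sq_le_sq₀ (norm_nonneg _) (by positivity)).1 hsq

end Dissipative

/-! ### Gradient inequalities and strong convexity -/

section ConvexGradient

variable {E : Type*} [NormedAddCommGroup E] [InnerProductSpace ℝ E] [CompleteSpace E]

theorem HasGradientAt.hasDerivAt_add_smul {f : E → ℝ} {f' x : E} (hf : HasGradientAt f f' x)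
    (v : E) : HasDerivAt (fun t : ℝ => f (x + t • v)) (inner ℝ f' v) 0 := by
  have h1 : HasDerivAt (fun t : ℝ => x + t • v) v 0 := by
    simpa using ((hasDerivAt_id (0 : ℝ)).smul_const v).const_add x
  have h2 : HasFDerivAt f (InnerProductSpace.toDual ℝ E f') (x + (0 : ℝ) • v) := by
    simpa using hf.hasFDerivAt
  exact (h2.comp_hasDerivAt (0 : ℝ) h1).congr_deriv (by simp)

/-- The gradient inequality for convex functions. -/
theorem ConvexOn.add_inner_le_of_hasGradientAt {f : E → ℝ} (hf : ConvexOn ℝ Set.univ f)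
    {f' x : E} (hx : HasGradientAt f f' x) (y : E) : f x + inner ℝ f' (y - x) ≤ f y := by
  have hconv : ConvexOn ℝ Set.univ (fun t : ℝ => f (x + t • (y - x))) := by
    have := hf.comp_affineMap (AffineMap.lineMap x y)
    rw [Set.preimage_univ] at this
    refine this.congr fun t _ => ?_
    simp [AffineMap.lineMap_apply, add_comm]
  have h := hconv.le_slope_of_hasDerivAt (Set.mem_univ 0) (Set.mem_univ 1) zero_lt_one
    (hx.hasDerivAt_add_smul (y - x))
  simp [slope_def_field] at h
  linarith

/-- The gradient inequality for strongly convex functions. -/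
theorem StrongConvexOn.add_inner_add_le_of_hasGradientAt {f : E → ℝ} {μ : ℝ}
    (hf : StrongConvexOn Set.univ μ f) {f' x : E} (hx : HasGradientAt f f' x) (y : E) :
    f x + inner ℝ f' (y - x) + μ / 2 * ‖y - x‖ ^ 2 ≤ f y := by
  -- Strong convexity is convexity after subtracting this quadratic, so the convex gradient
  -- inequality applies to the difference.
  have hg : HasGradientAt (fun x => f x - μ / 2 * ‖x‖ ^ 2) (f' - μ • x) x := by
    rw [hasGradientAt_iff_hasFDerivAt]
    refine (hx.hasFDerivAt.sub ((hasStrictFDerivAt_norm_sq x).hasFDerivAt.const_mul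
      (μ / 2))).congr_fderiv ?_
    ext v
    simp
    ring
  have h := (strongConvexOn_iff_convex.1 hf).add_inner_le_of_hasGradientAt hg y
  have hexp : ‖y‖ ^ 2 = ‖x‖ ^ 2 + 2 * inner ℝ x (y - x) + ‖y - x‖ ^ 2 := by
    rw [← norm_add_sq_real]
    simp
  rw [inner_sub_left, real_inner_smul_left, hexp] at h
  linarith

/-- The gradient of a strongly convex function is strongly monotone. -/
theorem StrongConvexOn.le_inner_sub_of_hasGradientAt {f : E → ℝ} {μ : ℝ}
    (hf : StrongConvexOn Set.univ μ f) {f' g' x y : E} (hx : HasGradientAt f f' x)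
    (hy : HasGradientAt f g' y) : μ * ‖x - y‖ ^ 2 ≤ inner ℝ (f' - g') (x - y) := by
  have h1 := hf.add_inner_add_le_of_hasGradientAt hx y
  have h2 := hf.add_inner_add_le_of_hasGradientAt hy x
  rw [norm_sub_rev, ← neg_sub x y, inner_neg_right] at h1
  rw [inner_sub_left]
  linarith

/-- A differentiable strongly convex function attains its minimum on a nonempty closed set. -/
theorem StrongConvexOn.exists_isMinOn_of_isClosed [ProperSpace E] {f : E → ℝ} {μ : ℝ}
    (hμ : 0 < μ) (hf : StrongConvexOn Set.univ μ f) (hd : Differentiable ℝ f) {S : Set E}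
    (hS : IsClosed S) (hne : S.Nonempty) : ∃ x ∈ S, ∀ y ∈ S, f x ≤ f y := by
  obtain ⟨x₀, hx₀⟩ := hne
  -- Beyond this radius the quadratic term outweighs the linear one and `f y ≥ f x₀`, so a minimizer
  -- over the compact part is global.
  set R : ℝ := 2 * ‖gradient f x₀‖ / μ with hR
  have hR0 : 0 ≤ R := by positivity
  obtain ⟨x, hx, hmin⟩ := ((isCompact_closedBall x₀ R).inter_left hS).exists_isMinOn
    ⟨x₀, hx₀, Metric.mem_closedBall_self hR0⟩ hd.continuous.continuousOn
  refine ⟨x, hx.1, fun y hy => ?_⟩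
  by_cases hyR : y ∈ Metric.closedBall x₀ R
  · exact hmin ⟨hy, hyR⟩
  · have h0 : f x ≤ f x₀ := hmin ⟨hx₀, Metric.mem_closedBall_self hR0⟩
    have h1 := hf.add_inner_add_le_of_hasGradientAt (hd x₀).hasGradientAt y
    have h2 := neg_le_of_abs_le (abs_real_inner_le_norm (gradient f x₀) (y - x₀))
    rw [mem_closedBall_iff_norm, not_le, hR, div_lt_iff₀ hμ] at hyR
    nlinarith [norm_nonneg (y - x₀)]

end ConvexGradient

/-! ### Linearly independent families and Farkas' lemma -/

section LinearIndependent

variable {E : Type*} [NormedAddCommGroup E] [InnerProductSpace ℝ E]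

/-- The Gram system of a linearly independent family is solvable. -/
theorem LinearIndependent.exists_inner_sum_smul_eq {ι : Type*} [Fintype ι] {a : ι → E}
    (ha : LinearIndependent ℝ a) (t : ι → ℝ) :
    ∃ c : ι → ℝ, ∀ k, inner ℝ (a k) (∑ j, c j • a j) = t k := by
  let T : (ι → ℝ) →ₗ[ℝ] (ι → ℝ) :=
    LinearMap.pi fun k => (innerₗ E (a k)).comp (Fintype.linearCombination ℝ a)
  have hT : ∀ c k, T c k = inner ℝ (a k) (∑ j, c j • a j) := by
    intro c k
    simp [T, Fintype.linearCombination_apply, inner_sum, real_inner_smul_right]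
  -- The Gram form `⟪T c, c⟫` is the squared norm of `∑ c k • a k`, which vanishes only for `c = 0`.
  have hinj : Function.Injective T := by
    rw [injective_iff_map_eq_zero]
    intro c hc
    have h0 : inner ℝ (∑ k, c k • a k) (∑ j, c j • a j) = (0 : ℝ) := by
      rw [sum_inner]
      refine Finset.sum_eq_zero fun k _ => ?_
      rw [real_inner_smul_left, ← hT, hc]
      simp
    exact funext (Fintype.linearIndependent_iff.1 ha c (inner_self_eq_zero.1 h0))
  obtain ⟨c, hc⟩ := LinearMap.injective_iff_surjective.1 hinj t
  exact ⟨c, fun k => by rw [← hT, hc]⟩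

/-- Linear combinations of a linearly independent family are bounded below. -/
theorem LinearIndependent.exists_sum_sq_le {ι : Type*} [Fintype ι] {a : ι → E}
    (ha : LinearIndependent ℝ a) :
    ∃ C : ℝ, 0 ≤ C ∧ ∀ c : ι → ℝ, ∑ k, c k ^ 2 ≤ C * ‖∑ k, c k • a k‖ ^ 2 := by
  classical
  -- The `s k` are the coefficients of the dual family, which reads off each `c k` as an inner
  -- product; Cauchy–Schwarz then bounds it.
  choose s hs using fun k => ha.exists_inner_sum_smul_eq (Pi.single k 1)
  refine ⟨∑ k, ‖∑ j, s k j • a j‖ ^ 2, by positivity, fun c => ?_⟩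
  rw [Finset.sum_mul]
  refine Finset.sum_le_sum fun k _ => ?_
  have h : c k = inner ℝ (∑ j, c j • a j) (∑ j, s k j • a j) := by
    rw [sum_inner]
    simp_rw [real_inner_smul_left, hs]
    simp [Pi.single_apply]
  rw [h, ← sq_abs, mul_comm, ← mul_pow]
  gcongr
  exact abs_real_inner_le_norm _ _

/-- Farkas' lemma for a linearly independent family, with strict inequalities in the premise. -/
theorem LinearIndependent.exists_nonneg_sum_eq {α β : Type*} [Fintype α] [Fintype β]
    {a : α → E} {b : β → E} (hab : LinearIndependent ℝ (Sum.elim a b)) {w : E}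
    (hw : ∀ v, (∀ i, inner ℝ (a i) v < 0) → (∀ j, inner ℝ (b j) v = 0) → inner ℝ w v ≤ 0) :
    ∃ (c : α → ℝ) (d : β → ℝ), (∀ i, 0 ≤ c i) ∧ w = ∑ i, c i • a i + ∑ j, d j • b j := by
  classical
  have hsolve : ∀ (s : α → ℝ) (t : β → ℝ), ∃ v, (∀ i, inner ℝ (a i) v = s i) ∧
      ∀ j, inner ℝ (b j) v = t j := by
    intro s t
    obtain ⟨c, hc⟩ := hab.exists_inner_sum_smul_eq (Sum.elim s t)
    exact ⟨_, fun i => hc (Sum.inl i), fun j => hc (Sum.inr j)⟩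
  have hw' : ∀ v, (∀ i, inner ℝ (a i) v ≤ 0) → (∀ j, inner ℝ (b j) v = 0) →
      inner ℝ w v ≤ 0 := by
    intro v hv1 hv2
    obtain ⟨d, hd1, hd2⟩ := hsolve (fun _ => -1) (fun _ => 0)
    by_contra! hpos
    -- Moving `v` by `ε • d` makes the inequalities strict and loses at most half of the positive
    -- value `⟪w, v⟫`.
    set ε : ℝ := inner ℝ w v / (2 * (|inner ℝ w d| + 1)) with hε
    have hε0 : 0 < ε := by positivity
    have h := hw (v + ε • d)
      (fun i => by
        rw [inner_add_right, real_inner_smul_right, hd1]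
        linarith [hv1 i])
      (fun j => by rw [inner_add_right, real_inner_smul_right, hd2, hv2]; simp)
    rw [inner_add_right, real_inner_smul_right] at h
    have h1 : ε * (2 * (|inner ℝ w d| + 1)) = inner ℝ w v := by
      rw [hε]
      field_simp
    nlinarith [neg_abs_le (inner ℝ w d), abs_nonneg (inner ℝ w d)]
  -- `p` is the orthogonal projection of `w` onto the span. The residual `w - p` is itself an
  -- admissible direction, so `‖w - p‖² = ⟪w, w - p⟫ ≤ 0`.
  obtain ⟨c, hc⟩ := hab.exists_inner_sum_smul_eq (fun k => inner ℝ (Sum.elim a b k) w)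
  set p : E := ∑ k, c k • Sum.elim a b k with hp
  have horth : ∀ k, inner ℝ (Sum.elim a b k) (w - p) = 0 := fun k => by
    rw [inner_sub_right, hc, sub_self]
  have hpq : inner ℝ p (w - p) = 0 := by
    conv_lhs => rw [hp]
    rw [sum_inner]
    exact Finset.sum_eq_zero fun k _ => by rw [real_inner_smul_left, horth, mul_zero]
  have hq : inner ℝ w (w - p) ≤ 0 :=
    hw' (w - p) (fun i => (horth (Sum.inl i)).le) (fun j => horth (Sum.inr j))
  have hwp : w = p := by
    have h : inner ℝ (w - p) (w - p) ≤ 0 := by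
      rw [inner_sub_left, hpq]
      linarith
    exact sub_eq_zero.1 (real_inner_self_nonpos.1 h)
  refine ⟨fun i => c (Sum.inl i), fun j => c (Sum.inr j), fun i => ?_, ?_⟩
  -- Testing with a direction that sees only `a i`, with value `-1`, gives `-c i ≤ 0`.
  · obtain ⟨v, hv1, hv2⟩ := hsolve (Pi.single i (-1)) 0
    have h := hw' v (fun k => by
      rw [hv1, Pi.single_apply]
      split_ifs <;> norm_num) hv2
    rw [hwp, hp, sum_inner, Fintype.sum_sum_type] at h
    simp only [real_inner_smul_left, Sum.elim_inl, Sum.elim_inr, hv1, hv2, Pi.single_apply,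
      Pi.zero_apply, mul_ite, mul_neg, mul_one, mul_zero, Finset.sum_ite_eq', Finset.mem_univ,
      if_true, Finset.sum_const_zero, add_zero] at h
    linarith
  · rw [hwp, hp, Fintype.sum_sum_type]
    simp

end LinearIndependent

/-! ### Existence and uniqueness of the KKT point -/

namespace ConvexProgram

variable {n mI mE : ℕ} (P : ConvexProgram n mI mE)

theorem hasGradientAt_f (x : EuclideanSpace ℝ (Fin n)) :
    HasGradientAt P.f (gradient P.f x) x :=
  (P.contDiff_f.differentiable one_ne_zero x).hasGradientAt

theorem hasGradientAt_g (i : Fin mI) (x : EuclideanSpace ℝ (Fin n)) :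
    HasGradientAt (P.g i) (gradient (P.g i) x) x :=
  ((P.contDiff_g i).differentiable one_ne_zero x).hasGradientAt

theorem inner_row (j : Fin mE) (v : EuclideanSpace ℝ (Fin n)) :
    inner ℝ (WithLp.toLp 2 (P.A j) : EuclideanSpace ℝ (Fin n)) v
      = Matrix.toEuclideanLin P.A v j := by
  simp [PiLp.inner_apply, Matrix.toLpLin_apply, Matrix.mulVec, dotProduct, mul_comm]

theorem transpose_eq_sum_smul_row (v : EuclideanSpace ℝ (Fin mE)) :
    Matrix.toEuclideanLin P.A.transpose v
      = ∑ j, v j • (WithLp.toLp 2 (P.A j) : EuclideanSpace ℝ (Fin n)) := by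
  ext k
  simp [Matrix.toLpLin_apply, Matrix.mulVec, dotProduct, mul_comm]

theorem inner_transpose (v : EuclideanSpace ℝ (Fin mE)) (w : EuclideanSpace ℝ (Fin n)) :
    inner ℝ (Matrix.toEuclideanLin P.A.transpose v) w
      = inner ℝ v (Matrix.toEuclideanLin P.A w) := by
  rw [transpose_eq_sum_smul_row, sum_inner, PiLp.inner_apply]
  refine Finset.sum_congr rfl fun j _ => ?_
  rw [real_inner_smul_left, inner_row]
  simp [mul_comm]

theorem isClosed_feasible : IsClosed {x | P.IsFeasible x} := by
  have h : {x | P.IsFeasible x}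
      = (⋂ i, {x | P.g i x ≤ 0}) ∩ {x | Matrix.toEuclideanLin P.A x = P.b} := by
    ext x
    simp [IsFeasible]
  rw [h]
  exact (isClosed_iInter fun i => isClosed_le (P.contDiff_g i).continuous continuous_const).inter
    (isClosed_eq (LinearMap.continuous_of_finiteDimensional _) continuous_const)

/-- A feasible strongly convex program has a solution. -/
theorem exists_isSolution {μ : ℝ} (hμ : 0 < μ) (hf : StrongConvexOn Set.univ μ P.f)
    (hfeas : ∃ x, P.IsFeasible x) : ∃ x, P.IsSolution x := by
  obtain ⟨x, hx, hmin⟩ := hf.exists_isMinOn_of_isClosed hμ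
    (P.contDiff_f.differentiable one_ne_zero) P.isClosed_feasible hfeas
  exact ⟨x, hx, hmin⟩

open Filter Topology in
/-- At a solution the objective does not decrease along strictly feasible directions. -/
theorem IsSolution.inner_gradient_nonneg {P : ConvexProgram n mI mE}
    {xs v : EuclideanSpace ℝ (Fin n)} (hxs : P.IsSolution xs)
    (hg : ∀ i ∈ P.activeSet xs, inner ℝ (gradient (P.g i) xs) v < 0)
    (hA : Matrix.toEuclideanLin P.A v = 0) : 0 ≤ inner ℝ (gradient P.f xs) v := by
  have hslope : ∀ {F : EuclideanSpace ℝ (Fin n) → ℝ} {F' : EuclideanSpace ℝ (Fin n)},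
      HasGradientAt F F' xs → Tendsto (fun t : ℝ => t⁻¹ * (F (xs + t • v) - F xs)) (𝓝[>] 0)
        (𝓝 (inner ℝ F' v)) := by
    intro F F' hF
    have := (hF.hasDerivAt_add_smul v).tendsto_slope_zero_right
    simpa using this
  -- Short steps stay feasible: inactive constraints by continuity, active ones because their slope
  -- along `v` is negative.
  have hcon : ∀ i, ∀ᶠ t : ℝ in 𝓝[>] 0, P.g i (xs + t • v) ≤ 0 := by
    intro i
    rcases (hxs.1.1 i).lt_or_eq with h | h
    · have hc : ContinuousAt (fun t : ℝ => P.g i (xs + t • v)) 0 :=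
        ((P.contDiff_g i).continuous.comp (by fun_prop)).continuousAt
      have : ∀ᶠ t : ℝ in 𝓝 0, P.g i (xs + t • v) < 0 := hc.eventually_lt_const (by simpa using h)
      filter_upwards [nhdsWithin_le_nhds this] with t ht using ht.le
    · filter_upwards [(hslope (P.hasGradientAt_g i xs)).eventually_lt_const (hg i h),
        self_mem_nhdsWithin] with t ht ht0
      rw [h, sub_zero] at ht
      exact (neg_of_mul_neg_right ht (inv_nonneg.2 (le_of_lt ht0))).le
  refine ge_of_tendsto (hslope (P.hasGradientAt_f xs)) ?_
  filter_upwards [eventually_all.2 hcon, self_mem_nhdsWithin] with t ht ht0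
  refine mul_nonneg (inv_nonneg.2 (le_of_lt ht0)) (sub_nonneg.2 (hxs.2 _ ⟨ht, ?_⟩))
  rw [map_add, map_smul, hA, smul_zero, add_zero, hxs.1.2]

/-- Under LICQ a solution extends to a KKT point. -/
theorem IsSolution.exists_isKKT {P : ConvexProgram n mI mE} {xs : EuclideanSpace ℝ (Fin n)}
    (hxs : P.IsSolution xs) (hL : P.LICQ xs) : ∃ z : PDSpace n mI mE, P.IsKKT z ∧ z.x = xs := by
  classical
  obtain ⟨c, d, hc, hw⟩ := LinearIndependent.exists_nonneg_sum_eq hL (w := -gradient P.f xs)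
    (fun v hv1 hv2 => by
      rw [inner_neg_left, neg_nonpos]
      refine hxs.inner_gradient_nonneg (fun i hi => hv1 ⟨i, hi⟩) ?_
      ext j
      rw [← inner_row, hv2]
      rfl)
  refine ⟨PDSpace.mk xs (WithLp.toLp 2 fun i => if h : i ∈ P.activeSet xs then c ⟨i, h⟩ else 0)
    (WithLp.toLp 2 d), ⟨?_, hxs.1, fun i => ?_, fun i => ?_⟩, rfl⟩
  · have hsum : ∑ i : P.activeSet xs, c i • gradient (P.g i) xs
        = ∑ i, (if h : i ∈ P.activeSet xs then c ⟨i, h⟩ else 0) • gradient (P.g i) xs :=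
      Fintype.sum_of_injective Subtype.val Subtype.val_injective _ _
        (fun i hi => by
          have : i ∉ P.activeSet xs := by simpa using hi
          simp [this])
        (fun i => by simp)
    rw [hsum] at hw
    change gradient P.f xs + Matrix.toEuclideanLin P.A.transpose (WithLp.toLp 2 d)
      + ∑ i, (if h : i ∈ P.activeSet xs then c ⟨i, h⟩ else 0) • gradient (P.g i) xs = 0
    rw [transpose_eq_sum_smul_row, ← neg_neg (gradient P.f xs), hw]
    abel
  · change 0 ≤ if h : i ∈ P.activeSet xs then c ⟨i, h⟩ else 0
    split_ifs
    · exact hc _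
    · exact le_rfl
  · change (if h : i ∈ P.activeSet xs then c ⟨i, h⟩ else 0) * P.g i xs = 0
    split_ifs with h
    · rw [show P.g i xs = 0 from h, mul_zero]
    · rw [zero_mul]

/-- Quadratic growth of the objective over the feasible set at a KKT point. -/
theorem IsKKT.add_le {P : ConvexProgram n mI mE} {μ : ℝ} (hf : StrongConvexOn Set.univ μ P.f)
    {z : PDSpace n mI mE} (hz : P.IsKKT z) {y : EuclideanSpace ℝ (Fin n)}
    (hy : P.IsFeasible y) : P.f z.x + μ / 2 * ‖y - z.x‖ ^ 2 ≤ P.f y := by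
  have h1 := hf.add_inner_add_le_of_hasGradientAt (P.hasGradientAt_f z.x) y
  have h2 := congrArg (fun w => inner ℝ w (y - z.x)) hz.stationarity
  simp only [inner_add_left, inner_transpose, map_sub, hy.2, hz.feasible.2, sub_self,
    inner_zero_right, inner_zero_left, sum_inner, real_inner_smul_left] at h2
  -- By convexity and complementarity each term is at most `λ_i g_i(y) ≤ 0`.
  have h3 : ∑ i, z.lam i * inner ℝ (gradient (P.g i) z.x) (y - z.x) ≤ 0 := by
    refine Finset.sum_nonpos fun i _ => ?_
    have h4 := (P.convex_g i).add_inner_le_of_hasGradientAt (P.hasGradientAt_g i z.x) y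
    have h5 := mul_le_mul_of_nonneg_left h4 (hz.lam_nonneg i)
    rw [mul_add, hz.complementarity i] at h5
    have h6 := mul_nonpos_of_nonneg_of_nonpos (hz.lam_nonneg i) (hy.1 i)
    linarith
  linarith

theorem IsKKT.isSolution {P : ConvexProgram n mI mE} {μ : ℝ} (hμ : 0 < μ)
    (hf : StrongConvexOn Set.univ μ P.f) {z : PDSpace n mI mE} (hz : P.IsKKT z) :
    P.IsSolution z.x :=
  ⟨hz.feasible, fun y hy => by
    have := hz.add_le hf hy
    nlinarith [sq_nonneg ‖y - z.x‖]⟩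

theorem IsSolution.eq {P : ConvexProgram n mI mE} {μ : ℝ} (hμ : 0 < μ)
    (hf : StrongConvexOn Set.univ μ P.f) {z : PDSpace n mI mE} (hz : P.IsKKT z)
    {y : EuclideanSpace ℝ (Fin n)} (hy : P.IsSolution y) : y = z.x := by
  have h1 := hz.add_le hf hy.1
  have h2 := hy.2 _ hz.feasible
  have h3 : ‖y - z.x‖ ^ 2 ≤ 0 := by nlinarith
  have h4 : ‖y - z.x‖ = 0 := by nlinarith [norm_nonneg (y - z.x)]
  exact sub_eq_zero.1 (norm_eq_zero.1 h4)

/-- The family of LICQ controls the multipliers, up to those of the inactive constraints. -/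
theorem LICQ.exists_sum_sq_le {P : ConvexProgram n mI mE} {xs : EuclideanSpace ℝ (Fin n)}
    (hL : P.LICQ xs) : ∃ C : ℝ, 0 ≤ C ∧
      ∀ (l : EuclideanSpace ℝ (Fin mI)) (v : EuclideanSpace ℝ (Fin mE)),
        (∀ i, i ∉ P.activeSet xs → l i = 0) →
        ‖l‖ ^ 2 + ‖v‖ ^ 2 ≤ C * ‖∑ i, l i • gradient (P.g i) xs
          + Matrix.toEuclideanLin P.A.transpose v‖ ^ 2 := by
  classical
  obtain ⟨C, hC0, hC⟩ := LinearIndependent.exists_sum_sq_le hL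
  refine ⟨C, hC0, fun l v hl => ?_⟩
  have h := hC (Sum.elim (fun i => l i) v)
  have hs1 : ∑ i : P.activeSet xs, l i ^ 2 = ∑ i, l i ^ 2 :=
    Fintype.sum_of_injective Subtype.val Subtype.val_injective _ _
      (fun i hi => by rw [hl i (by simpa using hi)]; simp) (fun i => rfl)
  have hs2 : ∑ i : P.activeSet xs, l i • gradient (P.g i) xs
      = ∑ i, l i • gradient (P.g i) xs :=
    Fintype.sum_of_injective Subtype.val Subtype.val_injective _ _
      (fun i hi => by rw [hl i (by simpa using hi)]; simp) (fun i => rfl)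
  simp only [Fintype.sum_sum_type, Sum.elim_inl, Sum.elim_inr, hs1, hs2] at h
  rw [transpose_eq_sum_smul_row, EuclideanSpace.real_norm_sq_eq, EuclideanSpace.real_norm_sq_eq]
  exact h

theorem IsKKT.lam_eq_zero {P : ConvexProgram n mI mE} {z : PDSpace n mI mE} (hz : P.IsKKT z)
    {i : Fin mI} (hi : i ∉ P.activeSet z.x) : z.lam i = 0 :=
  (mul_eq_zero.1 (hz.complementarity i)).resolve_right hi

/-- Under LICQ the KKT point is unique. -/
theorem IsKKT.eq {P : ConvexProgram n mI mE} {μ : ℝ} (hμ : 0 < μ)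
    (hf : StrongConvexOn Set.univ μ P.f) {z zs : PDSpace n mI mE} (hzs : P.IsKKT zs)
    (hL : P.LICQ zs.x) (hz : P.IsKKT z) : z = zs := by
  have hx : z.x = zs.x := IsSolution.eq hμ hf hzs (hz.isSolution hμ hf)
  obtain ⟨C, hC0, hC⟩ := hL.exists_sum_sq_le
  -- Both multipliers vanish off the active set, and subtracting the stationarity equations shows
  -- that their difference exerts no force.
  have h := hC (z.lam - zs.lam) (z.nu - zs.nu) (fun i hi => by
    rw [PiLp.sub_apply, hzs.lam_eq_zero hi, hz.lam_eq_zero (hx ▸ hi), sub_zero])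
  have h1 := hz.stationarity
  rw [hx] at h1
  have h2 : ∑ i, (z.lam - zs.lam) i • gradient (P.g i) zs.x
      + Matrix.toEuclideanLin P.A.transpose (z.nu - zs.nu) = 0 := by
    simp only [PiLp.sub_apply, sub_smul, Finset.sum_sub_distrib, map_sub]
    rw [← sub_self (0 : EuclideanSpace ℝ (Fin n))]
    nth_rewrite 1 [← h1]
    rw [← hzs.stationarity]
    abel
  rw [h2] at h
  simp only [norm_zero, ne_eq, OfNat.ofNat_ne_zero, not_false_eq_true, zero_pow, mul_zero] at h
  have hl : ‖z.lam - zs.lam‖ = 0 := by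
    nlinarith [sq_nonneg ‖z.nu - zs.nu‖, norm_nonneg (z.lam - zs.lam)]
  have hv : ‖z.nu - zs.nu‖ = 0 := by
    nlinarith [sq_nonneg ‖z.lam - zs.lam‖, norm_nonneg (z.nu - zs.nu)]
  rw [norm_eq_zero, sub_eq_zero] at hl hv
  have : ∀ y : PDSpace n mI mE, y = PDSpace.mk y.x y.lam y.nu := fun _ => rfl
  rw [this z, this zs, hx, hl, hv]

end ConvexProgram

/-! ### Locally Lipschitz products and sums -/

section LocallyLipschitz

theorem LocallyLipschitz.smul_of_real {X F : Type*} [PseudoMetricSpace X] [NormedAddCommGroup F]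
    [NormedSpace ℝ F] {s : X → ℝ} {v : X → F} (hs : LocallyLipschitz s)
    (hv : LocallyLipschitz v) : LocallyLipschitz fun x => s x • v x :=
  (contDiff_smul (𝕜 := ℝ) (F := F) (n := 1)).locallyLipschitz.comp (hs.prodMk hv)

theorem LocallyLipschitz.sum_univ {X F ι : Type*} [PseudoMetricSpace X] [NormedAddCommGroup F]
    [Fintype ι] {v : ι → X → F} (hv : ∀ i, LocallyLipschitz (v i)) :
    LocallyLipschitz fun x => ∑ i, v i x := by
  classical
  have h : ∀ s : Finset ι, LocallyLipschitz fun x => ∑ i ∈ s, v i x := by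
    intro s
    induction s using Finset.induction_on with
    | empty => simpa using LocallyLipschitz.const (0 : F)
    | insert i s hi ih =>
      simp only [Finset.sum_insert hi]
      exact (hv i).add ih
  exact h Finset.univ

end LocallyLipschitz

/-! ### Coordinates on the primal-dual space -/

namespace PDSpace

variable {n mI mE : ℕ}

/-- The primal component as a continuous linear map. -/
noncomputable def xL (n mI mE : ℕ) : PDSpace n mI mE →L[ℝ] EuclideanSpace ℝ (Fin n) :=
  WithLp.fstL 2 ℝ _ _

/-- The inequality multipliers as a continuous linear map. -/
noncomputable def lamL (n mI mE : ℕ) : PDSpace n mI mE →L[ℝ] EuclideanSpace ℝ (Fin mI) :=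
  (WithLp.fstL 2 ℝ _ _).comp (WithLp.sndL 2 ℝ _ _)

/-- The equality multipliers as a continuous linear map. -/
noncomputable def nuL (n mI mE : ℕ) : PDSpace n mI mE →L[ℝ] EuclideanSpace ℝ (Fin mE) :=
  (WithLp.sndL 2 ℝ _ _).comp (WithLp.sndL 2 ℝ _ _)

theorem xL_apply (z : PDSpace n mI mE) : xL n mI mE z = z.x := rfl

theorem lamL_apply (z : PDSpace n mI mE) : lamL n mI mE z = z.lam := rfl

theorem nuL_apply (z : PDSpace n mI mE) : nuL n mI mE z = z.nu := rfl

theorem inner_eq (a b : PDSpace n mI mE) :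
    inner ℝ a b = inner ℝ a.x b.x + inner ℝ a.lam b.lam + inner ℝ a.nu b.nu := by
  simp [WithLp.prod_inner_apply, add_assoc]

theorem norm_sq_eq (a : PDSpace n mI mE) :
    ‖a‖ ^ 2 = ‖a.x‖ ^ 2 + ‖a.lam‖ ^ 2 + ‖a.nu‖ ^ 2 := by
  rw [WithLp.prod_norm_sq_eq_of_L2, WithLp.prod_norm_sq_eq_of_L2, add_assoc]

theorem norm_mk_sq (x : EuclideanSpace ℝ (Fin n)) (l : EuclideanSpace ℝ (Fin mI))
    (v : EuclideanSpace ℝ (Fin mE)) : ‖mk x l v‖ ^ 2 = ‖x‖ ^ 2 + ‖l‖ ^ 2 + ‖v‖ ^ 2 :=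
  norm_sq_eq _

theorem norm_x_le (a : PDSpace n mI mE) : ‖a.x‖ ≤ ‖a‖ := WithLp.norm_fst_le _ a

theorem abs_lam_le (a : PDSpace n mI mE) (i : Fin mI) : |a.lam i| ≤ ‖a‖ :=
  (PiLp.norm_apply_le a.lam i).trans ((WithLp.norm_fst_le _ a.snd).trans (WithLp.norm_snd_le _ a))

end PDSpace

/-! ### Dissipation and regularity of the vector field -/

namespace ConvexProgram

variable {n mI mE : ℕ} (P : ConvexProgram n mI mE)

/-- The vector `([ρ g_i(x) + λ_i]₊ - λ_i)_i`. -/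
noncomputable def multiplierStep (ρ : ℝ) (z : PDSpace n mI mE) : EuclideanSpace ℝ (Fin mI) :=
  WithLp.toLp 2 fun i => max (ρ * P.g i z.x + z.lam i) 0 - z.lam i

theorem multiplierStep_apply (ρ : ℝ) (z : PDSpace n mI mE) (i : Fin mI) :
    P.multiplierStep ρ z i = max (ρ * P.g i z.x + z.lam i) 0 - z.lam i := rfl

theorem augPDGD_x (ρ : ℝ) (z : PDSpace n mI mE) :
    (P.augPDGD ρ z).x = -gradient P.f z.x - Matrix.toEuclideanLin P.A.transpose z.nu
      - ∑ i, max (ρ * P.g i z.x + z.lam i) 0 • gradient (P.g i) z.x := rfl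

theorem augPDGD_lam (ρ : ℝ) (z : PDSpace n mI mE) :
    (P.augPDGD ρ z).lam = ρ⁻¹ • P.multiplierStep ρ z := by
  ext i
  exact div_eq_inv_mul _ _

theorem augPDGD_nu (ρ : ℝ) (z : PDSpace n mI mE) :
    (P.augPDGD ρ z).nu = Matrix.toEuclideanLin P.A z.x - P.b := rfl

/-- The scalar dissipation inequality for a projected multiplier. -/
theorem posPart_dissipation {ρ g gs l ls : ℝ} (hρ : 0 < ρ) (hls : 0 ≤ ls) (hgs : gs ≤ 0)
    (hc : ls * gs = 0) :
    -(max (ρ * g + l) 0 - ls) * (g - gs) + ρ⁻¹ * (max (ρ * g + l) 0 - l) * (l - ls)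
      ≤ -(ρ⁻¹ * (max (ρ * g + l) 0 - l) ^ 2) := by
  suffices h : ρ * (-(max (ρ * g + l) 0 - ls) * (g - gs)) + (max (ρ * g + l) 0 - l) * (l - ls)
      + (max (ρ * g + l) 0 - l) ^ 2 ≤ 0 by
    have h1 := mul_nonpos_of_nonneg_of_nonpos (inv_nonneg.2 hρ.le) h
    have h2 : ρ⁻¹ * ρ = 1 := inv_mul_cancel₀ hρ.ne'
    have h3 : ρ⁻¹ * (ρ * (-(max (ρ * g + l) 0 - ls) * (g - gs)))
      = -(max (ρ * g + l) 0 - ls) * (g - gs) := by rw [← mul_assoc, h2, one_mul]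
    rw [mul_add, mul_add, h3] at h1
    linarith
  rcases le_total (ρ * g + l) 0 with h | h
  · rw [max_eq_right h]
    have := mul_nonpos_of_nonneg_of_nonpos hls h
    linear_combination this - ρ * hc
  · rw [max_eq_left h]
    have := mul_nonpos_of_nonneg_of_nonpos (mul_nonneg hρ.le h) hgs
    linear_combination this - ρ * hc

/-- A KKT multiplier is a fixed point of the projected multiplier update. -/
theorem IsKKT.posPart_eq {P : ConvexProgram n mI mE} {ρ : ℝ} (hρ : 0 < ρ)
    {zs : PDSpace n mI mE} (hzs : P.IsKKT zs) (i : Fin mI) :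
    max (ρ * P.g i zs.x + zs.lam i) 0 = zs.lam i := by
  rcases mul_eq_zero.1 (hzs.complementarity i) with h | h
  · rw [h, add_zero, max_eq_right (mul_nonpos_of_nonneg_of_nonpos hρ.le (hzs.feasible.1 i))]
  · rw [h, mul_zero, zero_add, max_eq_left (hzs.lam_nonneg i)]

/-- A KKT point is an equilibrium. -/
theorem IsKKT.augPDGD_eq_zero {P : ConvexProgram n mI mE} {ρ : ℝ} (hρ : 0 < ρ)
    {zs : PDSpace n mI mE} (hzs : P.IsKKT zs) : P.augPDGD ρ zs = 0 := by
  have hx : (P.augPDGD ρ zs).x = 0 := by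
    rw [augPDGD_x]
    simp only [hzs.posPart_eq hρ]
    rw [← neg_eq_zero, ← hzs.stationarity]
    abel
  have hl : (P.augPDGD ρ zs).lam = 0 := by
    rw [augPDGD_lam]
    ext i
    simp [multiplierStep_apply, hzs.posPart_eq hρ]
  have hv : (P.augPDGD ρ zs).nu = 0 := by
    rw [augPDGD_nu, hzs.feasible.2, sub_self]
  have h := PDSpace.norm_sq_eq (P.augPDGD ρ zs)
  rw [hx, hl, hv] at h
  simpa using h

/-- The vector field in error coordinates: the primal part. -/
theorem IsKKT.augPDGD_x_eq {P : ConvexProgram n mI mE} (ρ : ℝ) {zs : PDSpace n mI mE}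
    (hzs : P.IsKKT zs) (z : PDSpace n mI mE) :
    (P.augPDGD ρ z).x = -(gradient P.f z.x - gradient P.f zs.x)
      - Matrix.toEuclideanLin P.A.transpose (z.nu - zs.nu)
      - ∑ i, (max (ρ * P.g i z.x + z.lam i) 0 • gradient (P.g i) z.x
        - zs.lam i • gradient (P.g i) zs.x) := by
  rw [augPDGD_x, Finset.sum_sub_distrib, map_sub]
  rw [← sub_eq_zero, ← neg_eq_zero, ← hzs.stationarity]
  abel

/-- The distance to a KKT point is dissipated. -/
theorem IsKKT.inner_augPDGD_le {P : ConvexProgram n mI mE} {ρ μ : ℝ} (hρ : 0 < ρ)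
    (hf : StrongConvexOn Set.univ μ P.f) {zs : PDSpace n mI mE} (hzs : P.IsKKT zs)
    (z : PDSpace n mI mE) :
    inner ℝ (P.augPDGD ρ z) (z - zs)
      ≤ -(μ * ‖z.x - zs.x‖ ^ 2 + ρ⁻¹ * ‖P.multiplierStep ρ z‖ ^ 2) := by
  rw [PDSpace.inner_eq, hzs.augPDGD_x_eq, augPDGD_lam, augPDGD_nu]
  change inner ℝ _ (z.x - zs.x) + inner ℝ _ (z.lam - zs.lam) + inner ℝ _ (z.nu - zs.nu) ≤ _
  have hA : Matrix.toEuclideanLin P.A z.x - P.b = Matrix.toEuclideanLin P.A (z.x - zs.x) := by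
    rw [map_sub, hzs.feasible.2]
  rw [hA, inner_sub_left, inner_sub_left, inner_neg_left, inner_transpose,
    real_inner_comm (z.nu - zs.nu), sum_inner, real_inner_smul_left,
    PiLp.inner_apply (P.multiplierStep ρ z),
    EuclideanSpace.real_norm_sq_eq (P.multiplierStep ρ z), Finset.mul_sum, Finset.mul_sum]
  have h1 := hf.le_inner_sub_of_hasGradientAt (P.hasGradientAt_f z.x) (P.hasGradientAt_f zs.x)
  -- The gradient inequalities at `x` and `x*`, weighted by `[ρ g_i(x) + λ_i]₊` and `λ*_i`, replace
  -- inner products by differences of `g_i` and reduce the claim to the scalar inequality. The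
  -- `A`-terms cancel in the total.
  have h2 : -∑ i, inner ℝ (max (ρ * P.g i z.x + z.lam i) 0 • gradient (P.g i) z.x
        - zs.lam i • gradient (P.g i) zs.x) (z.x - zs.x)
      + ∑ i, ρ⁻¹ * inner ℝ (P.multiplierStep ρ z i) ((z.lam - zs.lam) i)
      ≤ -∑ i, ρ⁻¹ * P.multiplierStep ρ z i ^ 2 := by
    rw [← Finset.sum_neg_distrib, ← Finset.sum_neg_distrib, ← Finset.sum_add_distrib]
    refine Finset.sum_le_sum fun i _ => ?_
    have h3 := posPart_dissipation (g := P.g i z.x) (l := z.lam i) hρ (hzs.lam_nonneg i)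
      (hzs.feasible.1 i) (hzs.complementarity i)
    have h4 := (P.convex_g i).add_inner_le_of_hasGradientAt (P.hasGradientAt_g i z.x) zs.x
    have h5 := (P.convex_g i).add_inner_le_of_hasGradientAt (P.hasGradientAt_g i zs.x) z.x
    rw [← neg_sub z.x zs.x, inner_neg_right] at h4
    have h6 := mul_le_mul_of_nonneg_left h4 (le_max_right (ρ * P.g i z.x + z.lam i) 0)
    have h7 := mul_le_mul_of_nonneg_left h5 (hzs.lam_nonneg i)
    rw [inner_sub_left, real_inner_smul_left, real_inner_smul_left, multiplierStep_apply]
    simp only [PiLp.sub_apply, RCLike.inner_apply, conj_trivial]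
    linarith
  linarith

theorem locallyLipschitz_augPDGD (ρ : ℝ) (hf : LocallyLipschitz (gradient P.f))
    (hg : ∀ i, LocallyLipschitz (gradient (P.g i))) : LocallyLipschitz (P.augPDGD ρ) := by
  have hx : LocallyLipschitz fun z : PDSpace n mI mE => z.x :=
    (PDSpace.xL n mI mE).lipschitz.locallyLipschitz
  have hl : ∀ i, LocallyLipschitz fun z : PDSpace n mI mE => z.lam i := fun i =>
    ((EuclideanSpace.proj i : EuclideanSpace ℝ (Fin mI) →L[ℝ] ℝ).comp
      (PDSpace.lamL n mI mE)).lipschitz.locallyLipschitz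
  have hu : ∀ i, LocallyLipschitz fun z : PDSpace n mI mE =>
      max (ρ * P.g i z.x + z.lam i) 0 := fun i =>
    (((LocallyLipschitz.const ρ).smul_of_real
      ((P.contDiff_g i).locallyLipschitz.comp hx)).add (hl i)).max_const 0
  have hAt : LocallyLipschitz fun z : PDSpace n mI mE =>
      Matrix.toEuclideanLin P.A.transpose z.nu :=
    ((LinearMap.toContinuousLinearMap (Matrix.toEuclideanLin P.A.transpose)).comp
      (PDSpace.nuL n mI mE)).lipschitz.locallyLipschitz
  have hA : LocallyLipschitz fun z : PDSpace n mI mE => Matrix.toEuclideanLin P.A z.x :=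
    ((LinearMap.toContinuousLinearMap (Matrix.toEuclideanLin P.A)).comp
      (PDSpace.xL n mI mE)).lipschitz.locallyLipschitz
  have h1 : LocallyLipschitz fun z => (P.augPDGD ρ z).x :=
    (((hf.comp hx).neg).sub hAt).sub
      (LocallyLipschitz.sum_univ fun i => (hu i).smul_of_real ((hg i).comp hx))
  have h2 : LocallyLipschitz fun z => (P.augPDGD ρ z).lam := by
    have heq : (fun z => (P.augPDGD ρ z).lam) = fun z : PDSpace n mI mE =>
        ∑ i, ((ρ⁻¹ : ℝ) • (max (ρ * P.g i z.x + z.lam i) 0 - z.lam i)) •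
          (EuclideanSpace.single i 1 : EuclideanSpace ℝ (Fin mI)) := by
      funext z
      ext j
      simp [augPDGD_lam, multiplierStep_apply, Pi.single_apply]
    rw [heq]
    exact LocallyLipschitz.sum_univ fun i => ((LocallyLipschitz.const ρ⁻¹).smul_of_real
      ((hu i).sub (hl i))).smul_of_real (LocallyLipschitz.const _)
  have h3 : LocallyLipschitz fun z => (P.augPDGD ρ z).nu := hA.sub (LocallyLipschitz.const P.b)
  -- The sup and Euclidean product norms are equivalent, so the components may be treated
  -- separately.
  have hmk : ∀ (E F : Type) [NormedAddCommGroup E] [NormedSpace ℝ E] [NormedAddCommGroup F]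
      [NormedSpace ℝ F], LocallyLipschitz fun y : E × F => WithLp.toLp 2 y := by
    intro E F _ _ _ _
    exact (WithLp.prodContinuousLinearEquiv 2 ℝ E F).symm.contDiff.locallyLipschitz
  exact (hmk _ _).comp (h1.prodMk ((hmk _ _).comp (h2.prodMk h3)))

end ConvexProgram

/-! ### The cross term and the control of the multipliers -/

namespace ConvexProgram

variable {n mI mE : ℕ} (P : ConvexProgram n mI mE)

/-- The map `(x, λ, ν) ↦ ∑ i, λ_i ∇g_i(xs) + Aᵀν`. -/
noncomputable def multiplierForce (xs : EuclideanSpace ℝ (Fin n)) :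
    PDSpace n mI mE →L[ℝ] EuclideanSpace ℝ (Fin n) :=
  ∑ i, ((EuclideanSpace.proj i : EuclideanSpace ℝ (Fin mI) →L[ℝ] ℝ).comp
      (PDSpace.lamL n mI mE)).smulRight (gradient (P.g i) xs)
    + (LinearMap.toContinuousLinearMap (Matrix.toEuclideanLin P.A.transpose)).comp
      (PDSpace.nuL n mI mE)

theorem multiplierForce_apply (xs : EuclideanSpace ℝ (Fin n)) (w : PDSpace n mI mE) :
    P.multiplierForce xs w = ∑ i, w.lam i • gradient (P.g i) xs
      + Matrix.toEuclideanLin P.A.transpose w.nu := by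
  simp [multiplierForce, PDSpace.lamL_apply, PDSpace.nuL_apply]

theorem multiplierForce_mk (xs x : EuclideanSpace ℝ (Fin n)) (l : EuclideanSpace ℝ (Fin mI))
    (v : EuclideanSpace ℝ (Fin mE)) :
    P.multiplierForce xs (PDSpace.mk x l v) = ∑ i, l i • gradient (P.g i) xs
      + Matrix.toEuclideanLin P.A.transpose v := P.multiplierForce_apply xs _

/-- The multiplier of an inactive constraint is controlled by the dissipation. -/
theorem IsKKT.exists_sq_lam_le {P : ConvexProgram n mI mE} {ρ h : ℝ} (hρ : 0 < ρ)
    {zs : PDSpace n mI mE} (hzs : P.IsKKT zs) {i : Fin mI} (hi : i ∉ P.activeSet zs.x) :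
    ∃ C : ℝ, 0 ≤ C ∧ ∀ z : PDSpace n mI mE, ‖z - zs‖ ≤ h →
      (z.lam i - zs.lam i) ^ 2
        ≤ C * (‖z.x - zs.x‖ ^ 2 + ‖P.multiplierStep ρ z‖ ^ 2) := by
  have hneg : P.g i zs.x < 0 := lt_of_le_of_ne (hzs.feasible.1 i) hi
  set γ : ℝ := -P.g i zs.x / 2 with hγ
  have hγ0 : 0 < γ := by rw [hγ]; linarith
  have hev : ∀ᶠ x in nhds zs.x, P.g i x < -γ :=
    (P.contDiff_g i).continuous.continuousAt.eventually_lt_const (by rw [hγ]; linarith)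
  obtain ⟨δ, hδ0, hδ⟩ := Metric.eventually_nhds_iff.1 hev
  -- One summand per case: the projection cuts off and the step is `-λ_i`; or `x` is at least `δ`
  -- away from `x*`; or the step is `ρ g_i(x) < -ργ`. In the last two, `|λ_i| ≤ h` suffices.
  refine ⟨1 + (h / δ) ^ 2 + (h / (ρ * γ)) ^ 2, by positivity, fun z hz => ?_⟩
  have hlam : |z.lam i| ≤ h := by
    have := (PDSpace.abs_lam_le (z - zs) i).trans hz
    change |z.lam i - zs.lam i| ≤ h at this
    rwa [hzs.lam_eq_zero hi, sub_zero] at this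
  have hlam2 : z.lam i ^ 2 ≤ h ^ 2 := sq_le_sq' (by linarith [neg_abs_le (z.lam i)])
    ((le_abs_self _).trans hlam)
  rw [hzs.lam_eq_zero hi, sub_zero]
  have hstep : (P.multiplierStep ρ z i) ^ 2 ≤ ‖P.multiplierStep ρ z‖ ^ 2 := by
    rw [← sq_abs]
    exact pow_le_pow_left₀ (abs_nonneg _) (PiLp.norm_apply_le (P.multiplierStep ρ z) i) 2
  have hscale : ∀ {s t : ℝ}, 0 < s → s ^ 2 ≤ t → h ^ 2 ≤ (h / s) ^ 2 * t := by
    intro s t hs hst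
    calc h ^ 2 = (h / s) ^ 2 * s ^ 2 := by field_simp
      _ ≤ _ := by gcongr
  have hX0 := sq_nonneg ‖z.x - zs.x‖
  have hd0 := sq_nonneg ‖P.multiplierStep ρ z‖
  have hq1 := sq_nonneg (h / δ)
  have hq2 := sq_nonneg (h / (ρ * γ))
  have hp1 := mul_nonneg hq1 hd0
  have hp2 := mul_nonneg hq2 hX0
  have hp3 := mul_nonneg hq1 hX0
  have hp4 := mul_nonneg hq2 hd0
  rcases le_or_gt δ ‖z.x - zs.x‖ with hfar | hnear
  · have := hscale hδ0 (pow_le_pow_left₀ hδ0.le hfar 2)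
    linarith
  · have hg : P.g i z.x < -γ := hδ (by rwa [dist_eq_norm])
    have hw : ρ * P.g i z.x < -(ρ * γ) := by
      have := mul_lt_mul_of_pos_left hg hρ
      linarith
    rw [multiplierStep_apply] at hstep
    rcases le_total (ρ * P.g i z.x + z.lam i) 0 with hneg' | hpos
    · rw [max_eq_right hneg', zero_sub, neg_sq] at hstep
      linarith
    · rw [max_eq_left hpos, add_sub_cancel_right] at hstep
      have h1 : (ρ * γ) ^ 2 ≤ (ρ * P.g i z.x) ^ 2 := by
        rw [← neg_sq (ρ * P.g i z.x)]
        exact pow_le_pow_left₀ (by positivity) (by linarith) 2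
      have := hscale (mul_pos hρ hγ0) (h1.trans hstep)
      linarith

/-- The error is controlled by the multiplier force and the dissipation. -/
theorem IsKKT.exists_norm_sq_le {P : ConvexProgram n mI mE} {ρ : ℝ} (h : ℝ) (hρ : 0 < ρ)
    {zs : PDSpace n mI mE} (hzs : P.IsKKT zs) (hL : P.LICQ zs.x) :
    ∃ κ C : ℝ, 0 < κ ∧ 0 ≤ C ∧ ∀ z : PDSpace n mI mE, ‖z - zs‖ ≤ h →
      ‖z - zs‖ ^ 2 ≤ κ * ‖P.multiplierForce zs.x (z - zs)‖ ^ 2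
        + C * (‖z.x - zs.x‖ ^ 2 + ‖P.multiplierStep ρ z‖ ^ 2) := by
  classical
  obtain ⟨CL, hCL0, hCL⟩ := hL.exists_sum_sq_le
  have hin : ∀ i, ∃ C : ℝ, 0 ≤ C ∧ ∀ z : PDSpace n mI mE, ‖z - zs‖ ≤ h →
      (if i ∈ P.activeSet zs.x then 0 else (z - zs).lam i) ^ 2
        ≤ C * (‖z.x - zs.x‖ ^ 2 + ‖P.multiplierStep ρ z‖ ^ 2) := by
    intro i
    by_cases hi : i ∈ P.activeSet zs.x
    · exact ⟨0, le_rfl, fun z _ => by simp [hi]⟩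
    · simp only [hi, if_false]
      exact hzs.exists_sq_lam_le hρ hi
  choose Ci hCi0 hCi using hin
  set S : ℝ := ∑ i, Ci i with hS
  have hS0 : 0 ≤ S := Finset.sum_nonneg fun i _ => hCi0 i
  set q := P.multiplierForce zs.x with hq
  refine ⟨4 * CL + 1, 1 + (4 * CL * ‖q‖ ^ 2 + 2) * S, by positivity, by positivity,
    fun z hz => ?_⟩
  set w := z - zs with hw
  set e : ℝ := ‖z.x - zs.x‖ ^ 2 + ‖P.multiplierStep ρ z‖ ^ 2 with he
  -- The inactive part of the multiplier error, bounded by the dissipation. LICQ is applied to the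
  -- rest, whose force differs from `q w` by the force of `lin`.
  let lin : EuclideanSpace ℝ (Fin mI) :=
    WithLp.toLp 2 fun i => if i ∈ P.activeSet zs.x then 0 else w.lam i
  have hlin : ‖lin‖ ^ 2 ≤ S * e := by
    rw [EuclideanSpace.real_norm_sq_eq, hS, Finset.sum_mul]
    exact Finset.sum_le_sum fun i _ => hCi i z hz
  have h1 := hCL (w.lam - lin) w.nu (fun i hi => by simp [lin, hi])
  have hforce : ∑ i, (w.lam - lin) i • gradient (P.g i) zs.x
      + Matrix.toEuclideanLin P.A.transpose w.nu = q w - q (PDSpace.mk 0 lin 0) := by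
    rw [hq, multiplierForce_apply, multiplierForce_mk]
    simp only [PiLp.sub_apply, sub_smul, Finset.sum_sub_distrib, map_zero]
    abel
  rw [hforce] at h1
  have h2 : ‖q (PDSpace.mk 0 lin 0)‖ ^ 2 ≤ ‖q‖ ^ 2 * ‖lin‖ ^ 2 := by
    have hn : ‖(PDSpace.mk 0 lin 0 : PDSpace n mI mE)‖ ^ 2 = ‖lin‖ ^ 2 := by
      simp
    rw [← hn, ← mul_pow]
    gcongr
    exact q.le_opNorm _
  have h3 : ‖q w - q (PDSpace.mk 0 lin 0)‖ ^ 2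
      ≤ 2 * ‖q w‖ ^ 2 + 2 * ‖q (PDSpace.mk 0 lin 0)‖ ^ 2 := by
    have := norm_sub_le (q w) (q (PDSpace.mk 0 lin 0))
    have := pow_le_pow_left₀ (norm_nonneg _) this 2
    nlinarith [sq_nonneg (‖q w‖ - ‖q (PDSpace.mk 0 lin 0)‖)]
  have h4 : ‖w.lam‖ ^ 2 ≤ 2 * ‖w.lam - lin‖ ^ 2 + 2 * ‖lin‖ ^ 2 := by
    have := norm_add_le (w.lam - lin) lin
    rw [sub_add_cancel] at this
    have := pow_le_pow_left₀ (norm_nonneg _) this 2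
    nlinarith [sq_nonneg (‖w.lam - lin‖ - ‖lin‖)]
  have h5 : ‖w.x‖ ^ 2 ≤ e := le_add_of_nonneg_right (sq_nonneg _)
  have h6 := mul_le_mul_of_nonneg_left h3 hCL0
  have h7 := mul_le_mul_of_nonneg_left h2 hCL0
  have h8 : (4 * CL * ‖q‖ ^ 2 + 2) * ‖lin‖ ^ 2 ≤ (4 * CL * ‖q‖ ^ 2 + 2) * (S * e) := by gcongr
  rw [PDSpace.norm_sq_eq]
  nlinarith [sq_nonneg ‖q w‖, sq_nonneg ‖w.nu‖]

/-- Up to the dissipation, the primal vector field is the negative multiplier force. -/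
theorem IsKKT.exists_residual_le {P : ConvexProgram n mI mE} {h ℓ : ℝ} (ρ : ℝ)
    {zs : PDSpace n mI mE} (hzs : P.IsKKT zs)
    (hf : ∀ x y, ‖gradient P.f x - gradient P.f y‖ ≤ ℓ * ‖x - y‖)
    (hg : ∀ i, ∃ M : ℝ, 0 ≤ M ∧ ∀ x ∈ Metric.closedBall zs.x h,
      ‖gradient (P.g i) x - gradient (P.g i) zs.x‖ ≤ M * ‖x - zs.x‖) :
    ∃ C : ℝ, 0 ≤ C ∧ ∀ z : PDSpace n mI mE, ‖z - zs‖ ≤ h →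
      ‖(P.augPDGD ρ z).x + P.multiplierForce zs.x (z - zs)‖ ^ 2
        ≤ C * (‖z.x - zs.x‖ ^ 2 + ‖P.multiplierStep ρ z‖ ^ 2) := by
  choose M hM0 hM using hg
  -- The coefficients of `∇g_i(x) - ∇g_i(x*)` are bounded only on the ball, by compactness; the
  -- constant thus depends on `h`.
  have hU : ∀ i, ∃ U : ℝ, ∀ z ∈ Metric.closedBall zs h,
      ‖max (ρ * P.g i z.x + z.lam i) 0‖ ≤ U := by
    intro i
    have hc := (P.contDiff_g i).continuous
    exact (isCompact_closedBall zs h).exists_bound_of_continuousOn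
      (Continuous.continuousOn (by fun_prop))
  choose U hU using hU
  set B : ℝ := |ℓ| + ∑ i, (|U i| * M i + ‖gradient (P.g i) zs.x‖) with hB
  refine ⟨2 * B ^ 2, by positivity, fun z hz => ?_⟩
  have hzx : z.x ∈ Metric.closedBall zs.x h :=
    mem_closedBall_iff_norm.2 ((PDSpace.norm_x_le (z - zs)).trans hz)
  set X : ℝ := ‖z.x - zs.x‖ with hX
  set d := P.multiplierStep ρ z with hd
  -- Since `[ρ g_i(x) + λ_i]₊ - λ*_i = d_i + (λ_i - λ*_i)`, the multiplier errors cancel, leaving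
  -- gradient differences and the step `d`.
  have heq : (P.augPDGD ρ z).x + P.multiplierForce zs.x (z - zs)
      = -((gradient P.f z.x - gradient P.f zs.x)
        + ∑ i, (max (ρ * P.g i z.x + z.lam i) 0 • (gradient (P.g i) z.x - gradient (P.g i) zs.x)
          + d i • gradient (P.g i) zs.x)) := by
    rw [hzs.augPDGD_x_eq, multiplierForce_apply]
    have hs : ∑ i, (max (ρ * P.g i z.x + z.lam i) 0 •
          (gradient (P.g i) z.x - gradient (P.g i) zs.x) + d i • gradient (P.g i) zs.x)
        = ∑ i, (max (ρ * P.g i z.x + z.lam i) 0 • gradient (P.g i) z.x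
          - zs.lam i • gradient (P.g i) zs.x)
          - ∑ i, (z - zs).lam i • gradient (P.g i) zs.x := by
      rw [← Finset.sum_sub_distrib]
      refine Finset.sum_congr rfl fun i _ => ?_
      change _ = _ - (z.lam i - zs.lam i) • gradient (P.g i) zs.x
      rw [hd, multiplierStep_apply]
      module
    rw [hs]
    change _ + (_ + Matrix.toEuclideanLin P.A.transpose (z.nu - zs.nu)) = _
    abel
  have hbound : ‖(P.augPDGD ρ z).x + P.multiplierForce zs.x (z - zs)‖ ≤ B * (X + ‖d‖) := by
    rw [heq, norm_neg]
    refine (norm_add_le _ _).trans ?_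
    rw [hB, add_mul, Finset.sum_mul]
    refine add_le_add ?_ ((norm_sum_le _ _).trans (Finset.sum_le_sum fun i _ => ?_))
    · refine (hf _ _).trans ?_
      have h1 : ℓ * X ≤ |ℓ| * X := mul_le_mul_of_nonneg_right (le_abs_self ℓ) (norm_nonneg _)
      have h2 : 0 ≤ |ℓ| * ‖d‖ := by positivity
      linarith
    · refine (norm_add_le _ _).trans ?_
      rw [norm_smul, norm_smul]
      have h1 : ‖max (ρ * P.g i z.x + z.lam i) 0‖ * ‖gradient (P.g i) z.x - gradient (P.g i) zs.x‖
          ≤ |U i| * (M i * X) :=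
        mul_le_mul ((hU i z (mem_closedBall_iff_norm.2 hz)).trans (le_abs_self _)) (hM i _ hzx)
          (norm_nonneg _) (abs_nonneg _)
      have h2 : ‖d i‖ * ‖gradient (P.g i) zs.x‖ ≤ ‖d‖ * ‖gradient (P.g i) zs.x‖ :=
        mul_le_mul_of_nonneg_right (PiLp.norm_apply_le _ _) (norm_nonneg _)
      have h3 : 0 ≤ |U i| * M i * ‖d‖ := mul_nonneg (mul_nonneg (abs_nonneg _) (hM0 i))
        (norm_nonneg _)
      have h4 : 0 ≤ ‖gradient (P.g i) zs.x‖ * X := by positivity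
      linarith
  calc _ ≤ (B * (X + ‖d‖)) ^ 2 := pow_le_pow_left₀ (norm_nonneg _) hbound 2
    _ ≤ _ := by nlinarith [mul_nonneg (sq_nonneg B) (sq_nonneg (X - ‖d‖))]

/-- The derivative of the multiplier force pairs with the primal error up to the dissipation. -/
theorem IsKKT.exists_norm_mul_multiplierForce_le {P : ConvexProgram n mI mE} (ρ : ℝ)
    {zs : PDSpace n mI mE} (hzs : P.IsKKT zs) :
    ∃ C : ℝ, 0 ≤ C ∧ ∀ z : PDSpace n mI mE,
      ‖z.x - zs.x‖ * ‖P.multiplierForce zs.x (P.augPDGD ρ z)‖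
        ≤ C * (‖z.x - zs.x‖ ^ 2 + ‖P.multiplierStep ρ z‖ ^ 2) := by
  set q := P.multiplierForce zs.x with hq
  set T := LinearMap.toContinuousLinearMap (Matrix.toEuclideanLin P.A) with hT
  set a : ℝ := ‖q‖ * ‖T‖ with ha
  set c : ℝ := ‖q‖ * |ρ⁻¹| with hc
  refine ⟨a + c, by positivity, fun z => ?_⟩
  -- The force ignores `ẋ`; only `λ̇` and `ν̇ = A(x - x*)` enter, and both are of the order of the
  -- square root of the dissipation.
  have hdrop : q (P.augPDGD ρ z) = q (PDSpace.mk 0 (ρ⁻¹ • P.multiplierStep ρ z) 0)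
      + q (PDSpace.mk 0 0 (T (z.x - zs.x))) := by
    have hA : (P.augPDGD ρ z).nu = T (z.x - zs.x) := by
      rw [augPDGD_nu, map_sub, hT]
      simp [hzs.feasible.2]
    rw [hq, multiplierForce_apply, multiplierForce_mk, multiplierForce_mk, augPDGD_lam, hA]
    simp
  have h1 : ‖q (PDSpace.mk 0 (ρ⁻¹ • P.multiplierStep ρ z) 0)‖
      ≤ c * ‖P.multiplierStep ρ z‖ := by
    refine (q.le_opNorm _).trans (le_of_eq ?_)
    rw [hc, mul_assoc]
    congr 1
    rw [← sq_eq_sq₀ (norm_nonneg _) (by positivity), PDSpace.norm_mk_sq]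
    simp [norm_smul]
  have h2 : ‖q (PDSpace.mk 0 0 (T (z.x - zs.x)))‖ ≤ a * ‖z.x - zs.x‖ := by
    refine (q.le_opNorm _).trans ?_
    rw [ha, mul_assoc]
    gcongr
    refine le_trans (le_of_eq ?_) (T.le_opNorm _)
    rw [← sq_eq_sq₀ (norm_nonneg _) (norm_nonneg _), PDSpace.norm_mk_sq]
    simp
  have h3 : ‖q (P.augPDGD ρ z)‖ ≤ c * ‖P.multiplierStep ρ z‖ + a * ‖z.x - zs.x‖ := by
    rw [hdrop]
    exact (norm_add_le _ _).trans (add_le_add h1 h2)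
  have ha0 : 0 ≤ a := by positivity
  have hc0 : 0 ≤ c := by positivity
  have h4 := mul_le_mul_of_nonneg_left h3 (norm_nonneg (z.x - zs.x))
  nlinarith [mul_nonneg hc0 (sq_nonneg (‖z.x - zs.x‖ - ‖P.multiplierStep ρ z‖)),
    mul_nonneg ha0 (sq_nonneg ‖P.multiplierStep ρ z‖), mul_nonneg hc0 (sq_nonneg ‖z.x - zs.x‖),
    mul_nonneg hc0 (sq_nonneg ‖P.multiplierStep ρ z‖)]

/-- The derivative of the cross term `⟪x - xs, ∑ i, (λ - λs)_i ∇g_i(xs) + Aᵀ(ν - νs)⟫`. -/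
theorem IsKKT.exists_crossTerm_le {P : ConvexProgram n mI mE} {ρ μ ℓ h : ℝ} (hρ : 0 < ρ)
    (hμ : 0 < μ) {zs : PDSpace n mI mE} (hzs : P.IsKKT zs) (hL : P.LICQ zs.x)
    (hf : ∀ x y, ‖gradient P.f x - gradient P.f y‖ ≤ ℓ * ‖x - y‖)
    (hg : ∀ i, ∃ M : ℝ, 0 ≤ M ∧ ∀ x ∈ Metric.closedBall zs.x h,
      ‖gradient (P.g i) x - gradient (P.g i) zs.x‖ ≤ M * ‖x - zs.x‖) :
    ∃ c > 0, ∃ C : ℝ, ∀ z, ‖z - zs‖ ≤ h →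
      inner ℝ (PDSpace.xL n mI mE (P.augPDGD ρ z)) (P.multiplierForce zs.x (z - zs))
        + inner ℝ (PDSpace.xL n mI mE (z - zs)) (P.multiplierForce zs.x (P.augPDGD ρ z))
        ≤ -c * ‖z - zs‖ ^ 2
          + C * (μ * ‖z.x - zs.x‖ ^ 2 + ρ⁻¹ * ‖P.multiplierStep ρ z‖ ^ 2) := by
  obtain ⟨C₁, hC₁, hres⟩ := hzs.exists_residual_le ρ hf hg
  obtain ⟨C₂, hC₂, hforce⟩ := hzs.exists_norm_mul_multiplierForce_le ρ
  obtain ⟨κ, C₃, hκ, hC₃, herr⟩ := hzs.exists_norm_sq_le h hρ hL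
  refine ⟨1 / (2 * κ), by positivity, (C₁ / 2 + C₂ + C₃ / (2 * κ)) * (μ⁻¹ + ρ), fun z hz => ?_⟩
  have h1 := hres z hz
  have h2 := hforce z
  have h3 := herr z hz
  set y := P.multiplierForce zs.x (z - zs)
  set e : ℝ := ‖z.x - zs.x‖ ^ 2 + ‖P.multiplierStep ρ z‖ ^ 2 with he
  -- Polarization, dropping `-‖ẋ‖² / 2`: since `ẋ + y` is a small residual, this produces the
  -- decisive term `-‖y‖² / 2`.
  have h4 : inner ℝ (PDSpace.xL n mI mE (P.augPDGD ρ z)) y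
      ≤ ‖(P.augPDGD ρ z).x + y‖ ^ 2 / 2 - ‖y‖ ^ 2 / 2 := by
    rw [PDSpace.xL_apply, norm_add_sq_real]
    linarith [sq_nonneg ‖(P.augPDGD ρ z).x‖]
  have h5 : inner ℝ (PDSpace.xL n mI mE (z - zs)) (P.multiplierForce zs.x (P.augPDGD ρ z))
      ≤ C₂ * e := (real_inner_le_norm _ _).trans h2
  have h6 : 1 / (2 * κ) * ‖z - zs‖ ^ 2 ≤ ‖y‖ ^ 2 / 2 + C₃ / (2 * κ) * e := by
    calc 1 / (2 * κ) * ‖z - zs‖ ^ 2 ≤ 1 / (2 * κ) * (κ * ‖y‖ ^ 2 + C₃ * e) := by gcongr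
      _ = _ := by field_simp
  have h7 : e ≤ (μ⁻¹ + ρ) * (μ * ‖z.x - zs.x‖ ^ 2 + ρ⁻¹ * ‖P.multiplierStep ρ z‖ ^ 2) := by
    have h8 : (μ⁻¹ + ρ) * (μ * ‖z.x - zs.x‖ ^ 2 + ρ⁻¹ * ‖P.multiplierStep ρ z‖ ^ 2)
        = e + ρ * μ * ‖z.x - zs.x‖ ^ 2 + μ⁻¹ * ρ⁻¹ * ‖P.multiplierStep ρ z‖ ^ 2 := by
      rw [he]
      field_simp
      ring
    rw [h8]
    have : 0 ≤ ρ * μ * ‖z.x - zs.x‖ ^ 2 := by positivity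
    have : 0 ≤ μ⁻¹ * ρ⁻¹ * ‖P.multiplierStep ρ z‖ ^ 2 := by positivity
    linarith
  have h9 := mul_le_mul_of_nonneg_left h7 (by positivity : 0 ≤ C₁ / 2 + C₂ + C₃ / (2 * κ))
  linarith

end ConvexProgram

/-! ### Semi-global exponential stability -/

theorem corollary1 {n mI mE : ℕ} (P : ConvexProgram n mI mE) (ρ μ ℓ : ℝ)
    (hρ : 0 < ρ) (hμ : 0 < μ)
    -- the program is feasible and `f` is `μ`-strongly convex
    (hfeas : ∃ x, P.IsFeasible x)
    (hf_strong : StrongConvexOn Set.univ μ P.f)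
    -- LICQ at the solution, and at least one active or equality constraint
    (hLICQ : ∀ xs, P.IsSolution xs → P.LICQ xs ∧ 0 < (P.activeSet xs).ncard + mE)
    -- `∇f` is `ℓ`-Lipschitz; each `∇g_i` is bounded and Lipschitz on balls around the solution
    (hf_lip : ∀ x y, ‖gradient P.f x - gradient P.f y‖ ≤ ℓ * ‖x - y‖)
    (hg_lip : ∀ xs, P.IsSolution xs → ∀ d : ℝ, 0 ≤ d → ∀ i, ∃ L M : ℝ, 0 ≤ L ∧ 0 ≤ M ∧
      (∀ x ∈ Metric.closedBall xs d, ‖gradient (P.g i) x‖ ≤ L) ∧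
      (∀ x ∈ Metric.closedBall xs d, ∀ y ∈ Metric.closedBall xs d,
        ‖gradient (P.g i) x - gradient (P.g i) y‖ ≤ M * ‖x - y‖)) :
    ∃ zs : PDSpace n mI mE,
      -- `zs` is the unique KKT point, and its primal part is an optimal solution
      P.IsKKT zs ∧ (∀ z, P.IsKKT z → z = zs) ∧ P.IsSolution zs.x ∧
      IsSemiGloballyExpStable (P.augPDGD ρ) (PDSpace.lamNonneg n mI mE) zs ∧
      -- the factor `M = 2` works for every `h`
      ∀ h : ℝ, 0 < h → ∃ β : ℝ, 0 < β ∧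
        ExpDecayFrom (P.augPDGD ρ) (PDSpace.lamNonneg n mI mE) zs h 2 β := by
  obtain ⟨xs, hxs⟩ := P.exists_isSolution hμ hf_strong hfeas
  obtain ⟨zs, hzs, rfl⟩ := hxs.exists_isKKT (hLICQ xs hxs).1
  have hL := (hLICQ _ hxs).1
  have hfl : LocallyLipschitz (gradient P.f) :=
    (LipschitzWith.of_dist_le_mul (K := ℓ.toNNReal) fun x y => by
      rw [dist_eq_norm, dist_eq_norm]
      exact (hf_lip x y).trans
        (mul_le_mul_of_nonneg_right (Real.le_coe_toNNReal ℓ) (norm_nonneg _))).locallyLipschitz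
  have hgl : ∀ i, LocallyLipschitz (gradient (P.g i)) := by
    intro i x
    -- The extra `1` makes the ball around `x*` a neighbourhood of `x`.
    obtain ⟨_, M, _, hM0, _, hM⟩ := hg_lip _ hxs (dist x zs.x + 1) (by positivity) i
    refine ⟨M.toNNReal, Metric.closedBall zs.x (dist x zs.x + 1),
      Metric.closedBall_mem_nhds_of_mem (Metric.mem_ball.2 (lt_add_one _)),
      LipschitzOnWith.of_dist_le_mul fun y hy w hw => ?_⟩
    rw [dist_eq_norm, dist_eq_norm, Real.coe_toNNReal M hM0]
    exact hM y hy w hw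
  have hlip : ∀ r : ℝ, ∃ K, LipschitzOnWith K (P.augPDGD ρ) (Metric.closedBall zs r) := fun r =>
    ((P.locallyLipschitz_augPDGD ρ hfl hgl).locallyLipschitzOn).exists_lipschitzOnWith_of_compact
      (isCompact_closedBall zs r)
  have hdecay : ∀ h : ℝ, 0 < h → ∃ β : ℝ, 0 < β ∧
      ExpDecayFrom (P.augPDGD ρ) (PDSpace.lamNonneg n mI mE) zs h 2 β := by
    intro h hh
    refine exists_expDecayFrom_two (PDSpace.xL n mI mE) (P.multiplierForce zs.x) hlip
      (fun z => by positivity) (fun z => hzs.inner_augPDGD_le hρ hf_strong z)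
      (hzs.exists_crossTerm_le hρ hμ hL hf_lip fun i => ?_) _
    obtain ⟨_, M, _, hM0, _, hM⟩ := hg_lip _ hxs h hh.le i
    exact ⟨M, hM0, fun x hx => hM x hx _ (Metric.mem_closedBall_self hh.le)⟩
  refine ⟨zs, hzs, fun z hz => hzs.eq hμ hf_strong hL hz, hxs,
    ⟨hzs.augPDGD_eq_zero hρ, fun h hh => ?_⟩, hdecay⟩
  obtain ⟨β, hβ, hd⟩ := hdecay h hh
  exact ⟨2, two_pos, β, hβ, hd⟩
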